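/- **Conventions.** A monoid $P$ is *toric* if it is commutative, finitely generated, integral, torsion free and saturated (not necessarily sharp). $P^\times$ is its group of units, $P^\sharp=P/P^\times$, $P^\vee=\mathrm{Hom}(P;\mathbb N)$, and $\dim P=\mathrm{rank}\,P^{\mathrm{gp}}$. A face of $P$ is a submonoid whose complement is a prime ideal, and the interior $P^\circ$ is the complement of the proper faces. Let $X_P=\mathrm{Hom}(P;([0,\infty),\cdot))$ with the weakest topology that makes all functions $x_p(x)=x(p)$ continuous. A smooth function on an open $O\subset X_P$ is one of the form $g(x_{p_1},\dots,x_{p_n})$ with $g$ smooth on the image of $O$ in $\mathbb R^n$ (locally the restriction of a smooth function on an open set). A map $f:O\to X_Q$ is an *interior b-map* if for each $q\in Q$ there are $p\in P$ and a smooth $h:O\to(0,\infty)$ with $f^*x_q=h\,x_p$. The minimal boundary face $X_{P^\times}\subset X_P$ is the set where $x_p=0$ for all $p\notin P^\times$. A *refinement* $\mathcal R$ of $Q^\vee$ is a family of toric submonoids of $Q^\vee$, closed under passing to faces, whose interiors partition $Q^\vee$, and such that each member lies in a maximal one, i.e. in a member of dimension $\dim Q^\vee$. Let $L=(Q^\vee)^{\mathrm{gp}}$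 and $L^\vee=\mathrm{Hom}(L;\mathbb Z)$. For $R\in\mathcal R$ maximal put $R^\vee=\{s\in L^\vee: s(R)\subset\mathbb N\}$. For $R_1,R_2\in\mathcal R$ maximal, with $S=R_1\cap R_2$, the localizations $\{r+q: r\in R_i^\vee,\ q\in L^\vee,\ q(S)=0\}$, $i=1,2$, are the same submonoid of $L^\vee$, and $X_{R_1^\vee}$, $X_{R_2^\vee}$ are glued along the open subset that is the model space of this monoid. The result of gluing all the $X_{R^\vee}$ is $[X_{Q^\sharp};\mathcal R]$. Fix an isomorphism $Q\cong Q^\sharp\times Q^\times$ that splits $Q$, and let $[X_Q;\mathcal R]=[X_{Q^\sharp};\mathcal R]\times X_{Q^\times}$, with the charts $X_{R^\vee}\times X_{Q^\times}=X_{R^\vee\times Q^\times}$, and with the blow-down map $\beta:[X_Q;\mathcal R]\to X_{Q^\sharp}\times X_{Q^\times}\cong X_Q$ induced by the maps $X_{R^\vee}\to X_{Q^\sharp}$ dual to $R\subset Q^\vee$. An interior b-map $O\to[X_Q;\mathcal R]$ is a continuous map that is an interior b-map in these charts. For $x\in O\cap X_{P^\times}$ and an interior b-map $f:O\to X_Q$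 with $f(x)\in X_{Q^\times}$, let $f_\natural:P^\vee\to Q^\vee$ be dual to the pull-back $f^*:\mathcal B_{f(x)}\to\mathcal B_x$ of germs of b-functions (functions locally of the form $h\,x_p$ with $h$ smooth and positive), where $P^\vee\cong\mathrm{Hom}(\mathcal B_x;\mathbb N)$ and $Q^\vee\cong\mathrm{Hom}(\mathcal B_{f(x)};\mathbb N)$ through the germs of the functions $x_p$ and $x_q$. **Lemma.** Let $P,Q$ be toric monoids, $O\subset X_P$ open, and $f:O\to X_Q$ an interior b-map. Suppose that $O$ meets the minimal boundary face $X_{P^\times}$ and that $f$ maps $O\cap X_{P^\times}$ into the minimal boundary face $X_{Q^\times}$ (it is enough that this holds at one point of $O\cap X_{P^\times}$). Let $\mathcal R$ be a refinement of $Q^\vee$. If $f_\natural:P^\vee\to Q^\vee$ factors through some $R\in\mathcal R$, then there is a unique lift of $f$ to an interior b-map $\tilde f:O\to[X_Q;\mathcal R]$ with $f=\beta\circ\tilde f$. It is unique even among the continuous maps $O\to[X_Q;\mathcal R]$ with this property. -/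

import Mathlib

noncomputable section

open Set Filter Topology
open scoped NNReal ContDiff

namespace GenCorners

/-! ### Toric monoids, faces, duals -/

/-- A toric monoid: a finitely generated, integral, torsion free, saturated commutative monoid,
not necessarily sharp. Saturation says that if `a - b ∈ P^gp` has a positive multiple in `P`, then
`a - b ∈ P`. -/
structure IsToric (P : Type*) [AddCommMonoid P] : Prop where
  fg : AddMonoid.FG P
  integral : ∀ p q r : P, p + r = q + r → p = q
  torsion_free : ∀ (n : ℕ) (p : P), n ≠ 0 → n • p = 0 → p = 0
  saturated : ∀ (n : ℕ) (a b c : P), n ≠ 0 → n • a = n • b + c → ∃ d, a = b + d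

/-- The dimension of a monoid, the rank of its group completion. -/
def dim (P : Type*) [AddCommMonoid P] : ℕ :=
  Module.finrank ℤ (Algebra.GrothendieckAddGroup P)

/-- The dual monoid `P^∨ = Hom(P; ℕ)`. -/
abbrev Dual (P : Type*) [AddCommMonoid P] : Type _ := P →+ ℕ

/-- `S` is a face of the submonoid `R`: a submonoid of `R` whose complement in `R` is a prime
ideal. -/
def IsFace {M : Type*} [AddCommMonoid M] (S R : AddSubmonoid M) : Prop :=
  S ≤ R ∧ ∀ a ∈ R, ∀ b ∈ R, a + b ∈ S → a ∈ S ∧ b ∈ S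

/-- The interior of a (sub)monoid `R`: the complement in `R` of all the proper faces of `R`. -/
def monoidInterior {M : Type*} [AddCommMonoid M] (R : AddSubmonoid M) : Set M :=
  {m | m ∈ R ∧ ∀ S : AddSubmonoid M, IsFace S R → m ∈ S → S = R}

/-- A (saturated) refinement of a monoid `M`, given as the family of the images in `M` of its
monoids: toric submonoids of `M`, closed under passing to faces, whose interiors partition `M`
(equivalently: the interior of each face of `M` is partitioned by the interiors of those members
that are contained in this face and in no smaller one), such that each member is contained in one
of the same dimension as `M`. -/
structure Refinement (M : Type*) [AddCommMonoid M] where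
  cones : Set (AddSubmonoid M)
  toric : ∀ R ∈ cones, IsToric R
  face_mem : ∀ R ∈ cones, ∀ S : AddSubmonoid M, IsFace S R → S ∈ cones
  partition : ∀ m : M, ∃! R : AddSubmonoid M, R ∈ cones ∧ m ∈ monoidInterior R
  le_maximal : ∀ R ∈ cones, ∃ R' ∈ cones, R ≤ R' ∧ dim R' = dim M

/-- The maximal monoids of a refinement, those of full dimension. -/
abbrev Refinement.MaxCone {M : Type*} [AddCommMonoid M] (𝓡 : Refinement M) : Type _ :=
  {R : AddSubmonoid M // R ∈ 𝓡.cones ∧ dim R = dim M}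

/-! ### Model spaces -/

/-- The model space `X_P = Hom(P; ℝ₊)` of monoid homomorphisms to `([0, ∞), ·, 1)`. -/
@[ext]
structure ModelSpace (P : Type*) [AddCommMonoid P] where
  toFun : P → ℝ≥0
  map_zero' : toFun 0 = 1
  map_add' : ∀ p q, toFun (p + q) = toFun p * toFun q

namespace ModelSpace

variable {P Q : Type*} [AddCommMonoid P] [AddCommMonoid Q]

/-- A point `x` of `X_P` is used as a function on `P`; the algebraic function `x_p` on `X_P` is
`fun x => x p`. -/
instance : CoeFun (ModelSpace P) (fun _ => P → ℝ≥0) := ⟨toFun⟩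

/-- The weakest topology for which all the algebraic functions `x_p` are continuous. -/
instance : TopologicalSpace (ModelSpace P) :=
  TopologicalSpace.induced (fun x => (x : P → ℝ≥0)) inferInstance

/-- The map `X_Q → X_P` induced by a homomorphism `P → Q`. -/
def comap (φ : P →+ Q) (x : ModelSpace Q) : ModelSpace P where
  toFun p := x (φ p)
  map_zero' := by rw [map_zero, x.map_zero']
  map_add' p q := by rw [map_add, x.map_add']

/-- The identification `X_P × X_Q = X_{P × Q}`. -/
def pair (x : ModelSpace P) (y : ModelSpace Q) : ModelSpace (P × Q) where
  toFun a := x a.1 * y a.2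
  map_zero' := by simp [x.map_zero', y.map_zero']
  map_add' a b := by
    simp only [Prod.fst_add, Prod.snd_add, x.map_add', y.map_add']
    ring

variable (P) in
/-- The minimal boundary face `X_{P^×}` of `X_P`: all `x_p` with `p` not a unit vanish there. -/
def minFace : Set (ModelSpace P) := {x | ∀ p, ¬ IsAddUnit p → x p = 0}

end ModelSpace

/-! ### Smooth functions, b-functions and b-maps -/

/-- `g` is a smooth function on an arbitrary subset `W ⊆ ℝⁿ`: near each point of `W` it is the
restriction of a smooth function defined on an open subset of `ℝⁿ`. -/
def SmoothOnSubset {n : ℕ} (W : Set (Fin n → ℝ)) (g : (Fin n → ℝ) → ℝ) : Prop :=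
  ∀ w ∈ W, ∃ V : Set (Fin n → ℝ), IsOpen V ∧ w ∈ V ∧
    ∃ G : (Fin n → ℝ) → ℝ, ContDiffOn ℝ ∞ G V ∧ EqOn g G (W ∩ V)

section Maps

variable {P Q : Type*} [AddCommMonoid P] [AddCommMonoid Q]

/-- The map `x_{p₁} × ⋯ × x_{pₙ} : X_P → ℝⁿ`. -/
def coords {n : ℕ} (p : Fin n → P) (x : ModelSpace P) : Fin n → ℝ := fun i => (x (p i) : ℝ)

/-- `f` is a smooth function on `O ⊆ X_P`: there `f = g(x_{p₁}, …, x_{pₙ})` for some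
`p₁, …, pₙ ∈ P` and some smooth function `g` on the image of `O` in `ℝⁿ`. -/
def IsSmoothOn (O : Set (ModelSpace P)) (f : ModelSpace P → ℝ) : Prop :=
  ∃ (n : ℕ) (p : Fin n → P) (g : (Fin n → ℝ) → ℝ),
    SmoothOnSubset (coords p '' O) g ∧ ∀ x ∈ O, f x = g (coords p x)

/-- `h` is a smooth function on `O` with values in `(0, ∞)`. -/
def IsSmoothPosOn (O : Set (ModelSpace P)) (h : ModelSpace P → ℝ≥0) : Prop :=
  IsSmoothOn O (fun x => (h x : ℝ)) ∧ ∀ x ∈ O, 0 < h x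

/-- `f : O ⊆ X_P → X_Q` is an interior b-map: for every `q ∈ Q`, there are `p ∈ P` and a positive
smooth function `h` on `O` such that `f^* x_q = h x_p` on `O`. -/
def IsInteriorBMapOn (O : Set (ModelSpace P)) (f : ModelSpace P → ModelSpace Q) : Prop :=
  ∀ q : Q, ∃ (p : P) (h : ModelSpace P → ℝ≥0), IsSmoothPosOn O h ∧ ∀ x ∈ O, f x q = h x * x p

/-- `b` is a b-function in a neighbourhood of `x`: on some open `V ∋ x` it has the form `h x_p`
with `p ∈ P` and `h` a positive smooth function on `V`. -/
def IsBFunctionAt (x : ModelSpace P) (b : ModelSpace P → ℝ≥0) : Prop :=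
  ∃ V : Set (ModelSpace P), IsOpen V ∧ x ∈ V ∧
    ∃ (p : P) (h : ModelSpace P → ℝ≥0), IsSmoothPosOn V h ∧ ∀ y ∈ V, b y = h y * y p

theorem IsSmoothPosOn.one (O : Set (ModelSpace P)) : IsSmoothPosOn O (fun _ => 1) :=
  ⟨⟨0, Fin.elim0, fun _ => 1, fun _ _ => ⟨univ, isOpen_univ, mem_univ _, fun _ => 1,
    contDiffOn_const, fun _ _ => rfl⟩, fun _ _ => by simp⟩, fun _ _ => one_pos⟩

theorem IsSmoothPosOn.mono {O O' : Set (ModelSpace P)} {h : ModelSpace P → ℝ≥0}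
    (hh : IsSmoothPosOn O h) (hO : O' ⊆ O) : IsSmoothPosOn O' h := by
  obtain ⟨⟨n, p, g, hg, hgf⟩, hpos⟩ := hh
  refine ⟨⟨n, p, g, fun w hw => ?_, fun x hx => hgf x (hO hx)⟩, fun x hx => hpos x (hO hx)⟩
  obtain ⟨V, hV, hwV, G, hG, hE⟩ := hg w (image_mono hO hw)
  exact ⟨V, hV, hwV, G, hG, hE.mono (inter_subset_inter_left _ (image_mono hO))⟩

theorem IsSmoothPosOn.mul {O : Set (ModelSpace P)} {h k : ModelSpace P → ℝ≥0}
    (hh : IsSmoothPosOn O h) (hk : IsSmoothPosOn O k) :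
    IsSmoothPosOn O (fun x => h x * k x) := by
  obtain ⟨⟨n, p, g, hg, hgf⟩, hpos⟩ := hh
  obtain ⟨⟨m, q, e, he, hef⟩, kpos⟩ := hk
  refine ⟨⟨n + m, Fin.append p q,
    fun w => g (fun i => w (Fin.castAdd m i)) * e (fun i => w (Fin.natAdd n i)), ?_, ?_⟩,
    fun x hx => mul_pos (hpos x hx) (kpos x hx)⟩
  · have c1 : ∀ x : ModelSpace P,
        (fun i => coords (Fin.append p q) x (Fin.castAdd m i)) = coords p x := by
      intro x; ext i; simp [coords]
    have c2 : ∀ x : ModelSpace P,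
        (fun i => coords (Fin.append p q) x (Fin.natAdd n i)) = coords q x := by
      intro x; ext i; simp [coords]
    rintro _ ⟨x, hx, rfl⟩
    obtain ⟨V, hV, hxV, G, hG, hGE⟩ := hg _ (mem_image_of_mem _ hx)
    obtain ⟨U, hU, hxU, E, hE, hEE⟩ := he _ (mem_image_of_mem _ hx)
    have d1 : ContDiff ℝ ∞ (fun (w : Fin (n + m) → ℝ) (i : Fin n) => w (Fin.castAdd m i)) := by
      fun_prop
    have d2 : ContDiff ℝ ∞ (fun (w : Fin (n + m) → ℝ) (i : Fin m) => w (Fin.natAdd n i)) := by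
      fun_prop
    refine ⟨(fun w i => w (Fin.castAdd m i)) ⁻¹' V ∩ (fun w i => w (Fin.natAdd n i)) ⁻¹' U,
      (hV.preimage d1.continuous).inter (hU.preimage d2.continuous), ⟨?_, ?_⟩,
      fun w => G (fun i => w (Fin.castAdd m i)) * E (fun i => w (Fin.natAdd n i)), ?_, ?_⟩
    · rw [mem_preimage, c1]; exact hxV
    · rw [mem_preimage, c2]; exact hxU
    · exact (hG.comp d1.contDiffOn fun w hw => hw.1).mul
        (hE.comp d2.contDiffOn fun w hw => hw.2)
    · rintro _ ⟨⟨y, hy, rfl⟩, hyV, hyU⟩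
      rw [mem_preimage, c1] at hyV
      rw [mem_preimage, c2] at hyU
      simp only [c1, c2]
      rw [hGE ⟨mem_image_of_mem _ hy, hyV⟩, hEE ⟨mem_image_of_mem _ hy, hyU⟩]
  · intro x hx
    have h1 := hgf x hx
    have h2 := hef x hx
    simp only at h1 h2
    simp only [NNReal.coe_mul, h1, h2]
    congr 2 <;> ext i <;> simp [coords]

/-- The stalk `𝓑_x` of the sheaf of b-functions on `X_P`: germs of b-functions at `x`, as a monoid
under multiplication. -/
def bStalk (x : ModelSpace P) : Submonoid (Germ (𝓝 x) ℝ≥0) where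
  carrier := {γ | ∃ b : ModelSpace P → ℝ≥0, IsBFunctionAt x b ∧ γ = (b : Germ (𝓝 x) ℝ≥0)}
  one_mem' := ⟨fun _ => 1, ⟨univ, isOpen_univ, mem_univ _, 0, fun _ => 1, .one _,
    fun y _ => by rw [y.map_zero', mul_one]⟩, rfl⟩
  mul_mem' := by
    rintro _ _ ⟨b, ⟨V, hV, hxV, p, h, hh, hb⟩, rfl⟩ ⟨c, ⟨U, hU, hxU, q, k, hk, hc⟩, rfl⟩
    refine ⟨fun y => b y * c y, ⟨V ∩ U, hV.inter hU, ⟨hxV, hxU⟩, p + q, fun y => h y * k y,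
      (hh.mono inter_subset_left).mul (hk.mono inter_subset_right), fun y hy => ?_⟩, rfl⟩
    simp only [hb y hy.1, hc y hy.2, y.map_add']
    ring

/-- The normal monoid at `x ∈ X_P` to the boundary face `F` that contains `x` in its interior,
`Hom(𝓑_x / 𝓑_x^×; ℕ) = Hom(𝓑_x; ℕ)` (a homomorphism to `ℕ` kills units). It is the fibre at `x` of
the trivial bundle of monoids `F × W(F)^∨`. If `x` lies in the minimal boundary face, then the
germs of the algebraic functions, `p ↦ [x_p]`, identify `P / P^×` with `𝓑_x / 𝓑_x^×`, and thus the
normal monoid with `P^∨`. -/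
abbrev NormalMonoid (x : ModelSpace P) : Type _ := Additive (bStalk x) →+ ℕ

/-- The pull-back `q ↦ [f^* x_q]` of the germs of algebraic functions on `X_Q`. -/
def pullbackGerm {O : Set (ModelSpace P)} {f : ModelSpace P → ModelSpace Q} (hO : IsOpen O)
    (hf : IsInteriorBMapOn O f) {x : ModelSpace P} (hx : x ∈ O) : Q →+ Additive (bStalk x) where
  toFun q := Additive.ofMul ⟨((fun y => f y q : ModelSpace P → ℝ≥0) : Germ (𝓝 x) ℝ≥0),
    fun y => f y q, ⟨O, hO, hx, hf q⟩, rfl⟩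
  map_zero' := by
    refine congrArg Additive.ofMul (Subtype.ext ?_)
    change ((fun y => f y 0 : ModelSpace P → ℝ≥0) : Germ (𝓝 x) ℝ≥0) =
      ((fun _ => 1 : ModelSpace P → ℝ≥0) : Germ (𝓝 x) ℝ≥0)
    exact congrArg _ (funext fun y => (f y).map_zero')
  map_add' a b := by
    refine congrArg Additive.ofMul (Subtype.ext ?_)
    change ((fun y => f y (a + b) : ModelSpace P → ℝ≥0) : Germ (𝓝 x) ℝ≥0) =
      ((fun y => f y a * f y b : ModelSpace P → ℝ≥0) : Germ (𝓝 x) ℝ≥0)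
    exact congrArg _ (funext fun y => (f y).map_add' a b)

/-- The homomorphism `f_♮` of an interior b-map `f`, read in the fibre at `x`: a normal vector
`v ∈ Hom(𝓑_x; ℕ)` is sent to its push-forward `v ∘ f^* ∈ Hom(𝓑_{f(x)}; ℕ)`, and this is recorded as
the element `q ↦ v [f^* x_q]` of `Q^∨`. -/
def natural {O : Set (ModelSpace P)} {f : ModelSpace P → ModelSpace Q} (hO : IsOpen O)
    (hf : IsInteriorBMapOn O f) {x : ModelSpace P} (hx : x ∈ O) : NormalMonoid x →+ Dual Q where
  toFun v := v.comp (pullbackGerm hO hf hx)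
  map_zero' := rfl
  map_add' _ _ := rfl

end Maps

/-! ### Blow-up of model spaces -/

section Lattice

variable {M : Type*} [AddCommMonoid M]

/-- The dual of a full-dimensional submonoid `R ⊆ M`, realized in the lattice dual to the group
completion `L` of `M`, `L^∨ = Hom(L; ℤ) = Hom(M; ℤ)`: the `s ∈ L^∨` that are nonnegative on `R`. -/
def dualCone (R : AddSubmonoid M) : AddSubmonoid (M →+ ℤ) where
  carrier := {s | ∀ m ∈ R, 0 ≤ s m}
  zero_mem' := fun _ _ => le_rfl
  add_mem' := fun ha hb m hm => add_nonneg (ha m hm) (hb m hm)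

/-- The group of all `q ∈ L^∨` that vanish on `S`. If `S` is a face of `R`, it is the group
completion of the face `S^⊥` of `R^∨`. -/
def annihilator (S : AddSubmonoid M) : AddSubmonoid (M →+ ℤ) where
  carrier := {q | ∀ m ∈ S, q m = 0}
  zero_mem' := fun _ _ => rfl
  add_mem' := fun ha hb m hm => by simp [ha m hm, hb m hm]

/-- For `S` a face of `R`, the localization `(S^⊥)⁻¹ R^∨ ⊆ L^∨`: all the sums `r + q` with
`r ∈ R^∨` and `q` vanishing on `S`. -/
def localization (R S : AddSubmonoid M) : AddSubmonoid (M →+ ℤ) := dualCone R ⊔ annihilator S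

theorem dualCone_le_localization (R S : AddSubmonoid M) : dualCone R ≤ localization R S :=
  le_sup_left

namespace Refinement

variable (𝓡 : Refinement M)

/-- The identification of `x₁ ∈ X_{R₁^∨}` with `x₂ ∈ X_{R₂^∨}`: with `S = R₁ ∩ R₂`, the points lie
in the open subsets `X_{(S^⊥)⁻¹ R₁^∨}` and `X_{(S^⊥)⁻¹ R₂^∨}`, i.e. extend to the localizations,
and they correspond to each other under the equality `(S^⊥)⁻¹ R₁^∨ = (S^⊥)⁻¹ R₂^∨` in `L^∨`. -/
def Glue (a b : Σ R : 𝓡.MaxCone, ModelSpace (dualCone R.1)) : Prop :=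
  ∃ (y₁ : ModelSpace (localization a.1.1 (a.1.1 ⊓ b.1.1)))
    (y₂ : ModelSpace (localization b.1.1 (a.1.1 ⊓ b.1.1))),
    y₁.comap (AddSubmonoid.inclusion (dualCone_le_localization _ _)) = a.2 ∧
    y₂.comap (AddSubmonoid.inclusion (dualCone_le_localization _ _)) = b.2 ∧
    ∀ s h₁ h₂, y₁ ⟨s, h₁⟩ = y₂ ⟨s, h₂⟩

/-- The push-out of the spaces `X_{R^∨}`, `R ∈ 𝓡` maximal: their disjoint union modulo the
equivalence relation generated by the identifications. For `M = P^∨` with `P` sharp, it is the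
blow-up `[X_P; 𝓡]`. -/
def Glued : Type _ := Quot 𝓡.Glue

instance : TopologicalSpace 𝓡.Glued := inferInstanceAs (TopologicalSpace (Quot 𝓡.Glue))

/-- The (inverse) chart `X_{R^∨} → [X_P; 𝓡]`. -/
def chart (R : 𝓡.MaxCone) (x : ModelSpace (dualCone R.1)) : 𝓡.Glued := Quot.mk _ ⟨R, x⟩

end Refinement

end Lattice

section BlowUp

variable {P Q : Type*} [AddCommMonoid P] [AddCommMonoid Q]

/-- The homomorphism `Q → R^∨` dual to the inclusion `R ⊆ Q^∨`, given by evaluation. -/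
def evalHom (R : AddSubmonoid (Dual Q)) : Q →+ dualCone R where
  toFun q := ⟨(Nat.castAddMonoidHom ℤ).comp (AddMonoidHom.eval q), fun _ _ => Int.natCast_nonneg _⟩
  map_zero' := by ext; simp
  map_add' a b := by ext; simp

/-- A splitting `Q ≅ Q^♯ × Q^×` of a monoid, given by its second component, a retraction of `Q`
onto its group of units. -/
structure Splitting (Q : Type*) [AddCommMonoid Q] where
  retract : Q →+ AddUnits Q
  retract_coe : ∀ u : AddUnits Q, retract (u : Q) = u

/-- The blow-up `[X_Q; 𝓡] = [X_{Q^♯}; 𝓡] × X_{Q^×}` of a model space by a refinement of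
`Q^∨ = (Q^♯)^∨`. For `Q` sharp the second factor is a point. -/
abbrev BlowUp (𝓡 : Refinement (Dual Q)) : Type _ := 𝓡.Glued × ModelSpace (AddUnits Q)

/-- The blow-down map of the sharp part, `z ↦ (q ↦ z (ev_q))`. It is induced by the maps
`X_{R^∨} → X_Q` dual to `R ⊆ Q^∨`. -/
def sharpBlowDown (𝓡 : Refinement (Dual Q)) : 𝓡.Glued → ModelSpace Q :=
  Quot.lift (fun a => a.2.comap (evalHom a.1.1)) (by
    rintro a b ⟨y₁, y₂, h₁, h₂, h⟩
    ext q : 2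
    rw [← h₁, ← h₂]
    exact h _ _ _)

/-- The blow-down map `β : [X_{Q^♯}; 𝓡] × X_{Q^×} → X_{Q^♯} × X_{Q^×} ≅ X_Q`, with respect to a
splitting `Q ≅ Q^♯ × Q^×`. -/
def blowDown (𝓡 : Refinement (Dual Q)) (σ : Splitting Q) (z : BlowUp 𝓡) : ModelSpace Q :=
  ((sharpBlowDown 𝓡 z.1).pair z.2).comap ((AddMonoidHom.id Q).prod σ.retract)

/-- `F : O ⊆ X_P → [X_Q; 𝓡]` is an interior b-map of manifolds with generalized corners: it is
continuous, and in each of the charts `X_{R^∨} × X_{Q^×} = X_{R^∨ × Q^×}` that cover the blow-up it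
is an interior b-map, on the part of `O` that is mapped to this chart. -/
def IsInteriorBMapToBlowUpOn (𝓡 : Refinement (Dual Q)) (O : Set (ModelSpace P))
    (F : ModelSpace P → BlowUp 𝓡) : Prop :=
  ContinuousOn F O ∧ ∀ R : 𝓡.MaxCone, ∃ φ : ModelSpace P → ModelSpace (dualCone R.1),
    (∀ x ∈ O, (F x).1 ∈ range (𝓡.chart R) → 𝓡.chart R (φ x) = (F x).1) ∧
    IsInteriorBMapOn {x | x ∈ O ∧ (F x).1 ∈ range (𝓡.chart R)} (fun x => (φ x).pair (F x).2)

end BlowUp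

end GenCorners

end

open Set Filter Topology
open scoped NNReal ContDiff

namespace GenCorners

/-! Existence. Enlarge `R` to a maximal monoid of the refinement. An element `s` of `R^∨` is a
difference of evaluations at two elements `a`, `b` of `Q` (`IsToric.exists_eq_eval_sub_eval`), so
its coordinate on the lift has to be the quotient of `f^* x_a = h₁ x_{p₁}` by `f^* x_b = h₂ x_{p₂}`.
At a point of the minimal face every `w ∈ P^∨` is a normal vector, because the germ of `h x_p`
determines `w(p)` (`IsToric.exists_normal`). Since `f_♮` lands in `R`, pairing it with `s` gives
`w(p₂) ≤ w(p₁)` for every `w`, and by toric duality `p₁ = p₂ + d`. The quotient is therefore the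
b-function `(h₁/h₂) x_d` on all of `O`. These functions are multiplicative in `s` on the dense set
where all coordinates are nonzero, hence on `O`, and so define a map to one chart
(`exists_lift_chart`). The units of `Q` supply the other factor of the blow-up.

Uniqueness. Where all coordinates are nonzero, the point downstairs determines all the quotients
above, so the blow-down map is injective there. An interior b-map sends such points to such points,
and they are dense in `O`. To pass to limits one needs the identifications between charts to be
closed: `Refinement.Compat` describes them by multiplicative equations
(`Refinement.glue_iff_compat`), and charts are open embeddings.

Both halves rest on convex geometry. Farkas' lemma gives toric duality, and also a functional that
separates two members of the refinement and vanishes only on their common face. Inverting its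
coordinate passes from either chart to the overlap. -/

/-! ### Farkas' lemma and separation in lattices. -/

/-- **Farkas' lemma** over `ℚ`. -/
theorem farkas {ι V : Type*} [AddCommGroup V] [Module ℚ V] (s : Finset ι) (a : ι → V) (g : V) :
    (∃ c : ι → ℚ, (∀ i, 0 ≤ c i) ∧ g = ∑ i ∈ s, c i • a i) ∨
      ∃ w : V →ₗ[ℚ] ℚ, (∀ i ∈ s, 0 ≤ w (a i)) ∧ w g < 0 := by
  classical
  induction s using Finset.induction_on generalizing a g with
  | empty =>
    by_cases hg : g = 0
    · exact Or.inl ⟨0, fun _ => le_rfl, by simp [hg]⟩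
    · have hwg : ∃ w : V →ₗ[ℚ] ℚ, w g ≠ 0 := by
        by_contra! h
        exact hg ((Module.forall_dual_apply_eq_zero_iff ℚ g).1 h)
      obtain ⟨w, hwg⟩ := hwg
      rcases lt_or_gt_of_ne hwg with h | h
      · exact Or.inr ⟨w, by simp, h⟩
      · exact Or.inr ⟨-w, by simp, by simpa using h⟩
  | insert i₀ s hi₀ ih =>
    rcases ih a g with ⟨c, hc, hg⟩ | ⟨w, hw, hwg⟩
    · refine Or.inl ⟨fun i => if i = i₀ then 0 else c i, fun i => ?_, ?_⟩
      · dsimp only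
        split_ifs
        exacts [le_rfl, hc i]
      · rw [Finset.sum_insert hi₀]
        beta_reduce
        rw [if_pos rfl, zero_smul, zero_add, hg]
        refine Finset.sum_congr rfl fun i hi => ?_
        rw [if_neg (ne_of_mem_of_not_mem hi hi₀)]
    rcases le_or_gt 0 (w (a i₀)) with h0 | h0
    · refine Or.inr ⟨w, fun i hi => ?_, hwg⟩
      rcases Finset.mem_insert.1 hi with rfl | hi
      exacts [h0, hw i hi]
    -- Now `w` is negative at both `g` and `a i₀`. Project along `a i₀` onto `ker w` and use the
    -- induction hypothesis there: a functional pulls back to one that kills `a i₀`, and a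
    -- nonnegative combination lifts with a nonnegative coefficient at `a i₀`, by the signs of `w`.
    set π : V →ₗ[ℚ] V := LinearMap.id - (w.smulRight ((w (a i₀))⁻¹ • a i₀)) with hπ
    have hπv : ∀ v, π v = v - (w v / w (a i₀)) • a i₀ := fun v => by
      simp [hπ, smul_smul, div_eq_mul_inv]
    rcases ih (fun i => π (a i)) (π g) with ⟨c, hc, hg⟩ | ⟨w', hw', hwg'⟩
    · refine Or.inl ⟨fun i => if i = i₀ then
        w g / w (a i₀) + ∑ i ∈ s, c i * -(w (a i) / w (a i₀)) else c i, fun i => ?_, ?_⟩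
      · dsimp only
        split_ifs
        · refine add_nonneg (div_nonneg_of_nonpos hwg.le h0.le) (Finset.sum_nonneg fun i hi =>
            mul_nonneg (hc i) (neg_nonneg.2 (div_nonpos_of_nonneg_of_nonpos (hw i hi) h0.le)))
        · exact hc i
      · rw [Finset.sum_insert hi₀]
        beta_reduce
        rw [if_pos rfl]
        have : ∑ i ∈ s, (if i = i₀ then
            w g / w (a i₀) + ∑ i ∈ s, c i * -(w (a i) / w (a i₀)) else c i) • a i =
            ∑ i ∈ s, c i • a i :=
          Finset.sum_congr rfl fun i hi => by rw [if_neg (ne_of_mem_of_not_mem hi hi₀)]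
        rw [this]
        simp only [hπv, smul_sub, Finset.sum_sub_distrib, smul_smul] at hg
        rw [← Finset.sum_smul] at hg
        simp only [mul_neg, Finset.sum_neg_distrib, neg_smul, add_smul]
        refine (sub_eq_iff_eq_add.1 hg).trans ?_
        abel
    · refine Or.inr ⟨w'.comp π, fun i hi => ?_, hwg'⟩
      rcases Finset.mem_insert.1 hi with rfl | hi
      · simp [hπv, div_self h0.ne]
      · exact hw' i hi

/-- Rational coefficients of a finite family have a common denominator. -/
theorem exists_common_denominator {ι : Type*} (s : Finset ι) (c : ι → ℚ) :
    ∃ N : ℕ, 0 < N ∧ ∃ z : ι → ℤ, ∀ i ∈ s, (N : ℚ) * c i = z i := by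
  classical
  refine ⟨∏ i ∈ s, (c i).den, Finset.prod_pos fun i _ => (c i).pos,
    fun i => (c i).num * ∏ k ∈ s.erase i, ((c k).den : ℤ), fun i hi => ?_⟩
  rw [← Finset.mul_prod_erase s _ hi]
  push_cast
  have := Rat.mul_den_eq_num (c i)
  rw [← this]; ring

/-- A lattice version of Farkas' lemma: if the functionals that are nonnegative on `A` and
nonpositive on `B` do not take a larger value at `b` than at `c`, then a multiple of `c - b` is a
combination of the elements of `A` and of the negatives of elements of `B`. -/
theorem exists_nsmul_add_eq {M ι : Type*} [AddCommMonoid M] [Finite ι] (j : M →+ (ι → ℤ))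
    (hj : Function.Injective j) (A B : Finset M) (b c : M)
    (h : ∀ w : M →+ ℤ, (∀ a ∈ A, 0 ≤ w a) → (∀ a ∈ B, w a ≤ 0) → w b ≤ w c) :
    ∃ k : ℕ, 0 < k ∧ ∃ r₁ ∈ AddSubmonoid.closure (A : Set M),
      ∃ r₂ ∈ AddSubmonoid.closure (B : Set M), k • b + r₁ = k • c + r₂ := by
  classical
  have := Fintype.ofFinite ι
  let J : M → (ι → ℚ) := fun m i => (j m i : ℚ)
  -- The cone generated by `A` and `-B`; the question is whether it contains `c - b`.
  let e : M ⊕ M → (ι → ℚ) := Sum.elim J (fun m => - J m)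
  rcases farkas (A.disjSum B) e (J c - J b) with ⟨d, hd, hsum⟩ | ⟨w, hw, hwg⟩
  · obtain ⟨N, hN, z, hz⟩ := exists_common_denominator (A.disjSum B) d
    have hz0 : ∀ i ∈ A.disjSum B, ((z i).toNat : ℚ) = N * d i := fun i hi => by
      have h1 : (0 : ℚ) ≤ z i := by rw [← hz i hi]; exact mul_nonneg (by positivity) (hd i)
      have h2 : 0 ≤ z i := by exact_mod_cast h1
      rw [hz i hi]; exact_mod_cast Int.toNat_of_nonneg h2
    refine ⟨N, hN, ∑ a ∈ A, (z (.inl a)).toNat • a, sum_mem fun a ha =>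
      nsmul_mem (AddSubmonoid.subset_closure ha) _, ∑ a ∈ B, (z (.inr a)).toNat • a,
      sum_mem fun a ha => nsmul_mem (AddSubmonoid.subset_closure ha) _, hj (funext fun i => ?_)⟩
    have h1 := congrFun hsum i
    rw [Finset.sum_disjSum] at h1
    simp only [Pi.add_apply, Pi.sub_apply, Finset.sum_apply, Pi.smul_apply, smul_eq_mul, e, J,
      Sum.elim_inl, Sum.elim_inr, Pi.neg_apply] at h1
    have h2 : ∀ a ∈ A, ((z (.inl a)).toNat : ℚ) = N * d (.inl a) := fun a ha =>
      hz0 _ (Finset.inl_mem_disjSum.2 ha)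
    have h3 : ∀ a ∈ B, ((z (.inr a)).toNat : ℚ) = N * d (.inr a) := fun a ha =>
      hz0 _ (Finset.inr_mem_disjSum.2 ha)
    have key : ((j (N • b + ∑ a ∈ A, (z (.inl a)).toNat • a) i : ℤ) : ℚ) =
        (j (N • c + ∑ a ∈ B, (z (.inr a)).toNat • a) i : ℤ) := by
      simp only [map_add, map_nsmul, map_sum, Pi.add_apply, Pi.smul_apply, Finset.sum_apply]
      simp only [nsmul_eq_mul, Int.cast_add, Int.cast_mul, Int.cast_natCast, Int.cast_sum]
      rw [Finset.sum_congr rfl fun a ha => by rw [h2 a ha],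
        Finset.sum_congr (s₁ := B) rfl fun a ha => by rw [h3 a ha]]
      have h4 := congrArg (fun t : ℚ => (N : ℚ) * t) h1
      simp only [mul_add, mul_sub, Finset.mul_sum, mul_neg, Finset.sum_neg_distrib,
        ← mul_assoc] at h4
      linarith
    exact_mod_cast key
  · exfalso
    -- Clearing denominators on the standard basis turns the rational functional `w` into the
    -- integral functional `N w`.
    obtain ⟨N, hN, z, hz⟩ := exists_common_denominator Finset.univ (fun i => w (Pi.single i 1))
    let W : M →+ ℤ := ⟨⟨fun m => ∑ i, z i * j m i, by simp⟩, fun m n => by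
      simp [mul_add, Finset.sum_add_distrib]⟩
    have hW : ∀ m, (W m : ℚ) = N * w (J m) := fun m => by
      have : J m = ∑ i, (j m i : ℚ) • Pi.single i (1 : ℚ) := by
        ext k
        simp [Finset.sum_apply, Pi.single_apply, J]
      rw [this, map_sum, Finset.mul_sum]
      simp only [W, AddMonoidHom.coe_mk, ZeroHom.coe_mk, Int.cast_sum, Int.cast_mul, map_smul,
        smul_eq_mul]
      refine Finset.sum_congr rfl fun i _ => ?_
      rw [← hz i (Finset.mem_univ i)]; ring
    have hN' : (0 : ℚ) < N := by exact_mod_cast hN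
    have := h W (fun a ha => by
      have h1 : 0 ≤ w (J a) := hw (.inl a) (Finset.inl_mem_disjSum.2 ha)
      have : (0 : ℚ) ≤ W a := by rw [hW]; positivity
      exact_mod_cast this) (fun a ha => by
      have h1 : 0 ≤ w (- J a) := hw (.inr a) (Finset.inr_mem_disjSum.2 ha)
      rw [map_neg] at h1
      have : (W a : ℚ) ≤ 0 := by rw [hW]; nlinarith
      exact_mod_cast this)
    have h2 : (W b : ℚ) ≤ W c := by exact_mod_cast this
    rw [hW, hW] at h2
    rw [map_sub] at hwg
    nlinarith

/-- A functional that is nonnegative on generators is nonnegative on the monoid. -/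
theorem nonneg_of_mem_closure {M : Type*} [AddCommMonoid M] (w : M →+ ℤ) {A : Set M}
    (h : ∀ a ∈ A, 0 ≤ w a) : ∀ m ∈ AddSubmonoid.closure A, 0 ≤ w m := fun m hm =>
  AddSubmonoid.closure_induction (motive := fun m _ => 0 ≤ w m) h (by simp)
    (fun x y _ _ hx hy => by rw [map_add]; exact add_nonneg hx hy) hm

/-- A functional that is nonnegative on `A` and positive on the elements of `A` outside the
submonoid `S` is positive on all elements outside `S` of the monoid generated by `A`. -/
theorem pos_of_mem_closure {M : Type*} [AddCommMonoid M] (w : M →+ ℤ) {A : Set M}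
    {S : AddSubmonoid M} (h : ∀ a ∈ A, 0 ≤ w a) (h' : ∀ a ∈ A, a ∉ S → 0 < w a) :
    ∀ m ∈ AddSubmonoid.closure A, m ∉ S → 0 < w m := fun m hm =>
  AddSubmonoid.closure_induction (motive := fun m _ => m ∉ S → 0 < w m) h'
    (fun h => absurd S.zero_mem h)
    (fun x y hx hy ihx ihy hxy => by
      rw [map_add]
      have h1 := nonneg_of_mem_closure w h x hx
      have h2 := nonneg_of_mem_closure w h y hy
      by_cases hxS : x ∈ S
      · have : y ∉ S := fun hyS => hxy (S.add_mem hxS hyS)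
        linarith [ihy this]
      · linarith [ihx hxS]) hm

/-- Two finitely generated monoids in a lattice that meet in a common face are separated by a
functional that vanishes only on this face. -/
theorem exists_separating {M ι : Type*} [AddCommMonoid M] [Finite ι] (j : M →+ (ι → ℤ))
    (hj : Function.Injective j) {R₁ R₂ : AddSubmonoid M} (h₁ : R₁.FG) (h₂ : R₂.FG)
    (f₁ : IsFace (R₁ ⊓ R₂) R₁) (f₂ : IsFace (R₁ ⊓ R₂) R₂) :
    ∃ w : M →+ ℤ, (∀ m ∈ R₁, 0 ≤ w m) ∧ (∀ m ∈ R₂, w m ≤ 0) ∧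
      (∀ m ∈ R₁, m ∉ R₂ → 0 < w m) ∧ (∀ m ∈ R₂, m ∉ R₁ → w m < 0) := by
  classical
  obtain ⟨A, rfl⟩ := h₁
  obtain ⟨B, rfl⟩ := h₂
  have key : ∀ (A B : Finset M) (R₁ R₂ : AddSubmonoid M), AddSubmonoid.closure (A : Set M) = R₁ →
      AddSubmonoid.closure (B : Set M) = R₂ → IsFace (R₁ ⊓ R₂) R₁ →
      ∃ w : M →+ ℤ, (∀ m ∈ R₁, 0 ≤ w m) ∧ (∀ m ∈ R₂, w m ≤ 0) ∧
        (∀ m ∈ R₁, m ∉ R₂ → 0 < w m) := by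
    rintro A B R₁ R₂ rfl rfl hf
    -- One functional per generator, to be summed. If none is positive at `a`, then a positive
    -- multiple of `a` plus an element of `R₁` lies in `R₂`, and the face condition forces `a ∈ R₂`.
    have hex : ∀ a ∈ A, ∃ w : M →+ ℤ, (∀ m ∈ A, 0 ≤ w m) ∧ (∀ m ∈ B, w m ≤ 0) ∧
        (a ∉ AddSubmonoid.closure (B : Set M) → 0 < w a) := by
      intro a ha
      by_contra! hcon
      have haB : a ∉ AddSubmonoid.closure (B : Set M) := fun h =>
        (hcon 0 (by simp) (by simp)).1 h
      obtain ⟨k, hk, r₁, hr₁, r₂, hr₂, he⟩ := exists_nsmul_add_eq j hj A B a 0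
        (fun w hA hB => by simpa using (hcon w hA hB).2)
      rw [smul_zero, zero_add] at he
      have haA := AddSubmonoid.subset_closure (s := (A : Set M)) ha
      obtain ⟨k, rfl⟩ : ∃ l, k = l + 1 := ⟨k - 1, by omega⟩
      have h3 := hf.2 a haA (k • a + r₁) (add_mem (nsmul_mem haA _) hr₁) (by
        have : a + (k • a + r₁) = r₂ := by rw [← he, succ_nsmul]; abel
        rw [this]
        refine ⟨?_, hr₂⟩
        rw [← he]
        exact add_mem (nsmul_mem haA _) hr₁)
      exact haB h3.1.2
    choose! w hwA hwB hwa using hex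
    have hB : ∀ b ∈ B, (∑ a ∈ A, w a) b ≤ 0 := fun b hb => by
      rw [AddMonoidHom.finsetSum_apply]
      exact Finset.sum_nonpos fun a ha => hwB a ha b hb
    have hA : ∀ b ∈ A, 0 ≤ (∑ a ∈ A, w a) b := fun b hb => by
      rw [AddMonoidHom.finsetSum_apply]
      exact Finset.sum_nonneg fun a ha => hwA a ha b hb
    refine ⟨∑ a ∈ A, w a, nonneg_of_mem_closure _ hA, fun m hm => ?_, pos_of_mem_closure _ hA ?_⟩
    · have := nonneg_of_mem_closure (-∑ a ∈ A, w a) (A := B) (fun b hb => by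
        rw [AddMonoidHom.neg_apply]; have := hB b hb; linarith) m hm
      rw [AddMonoidHom.neg_apply] at this
      linarith
    · intro a ha haB
      rw [AddMonoidHom.finsetSum_apply]
      exact Finset.sum_pos' (fun b hb => hwA b hb a ha) ⟨a, ha, hwa a ha haB⟩
  obtain ⟨w, w1, w2, w3⟩ := key A B _ _ rfl rfl f₁
  obtain ⟨u, u1, u2, u3⟩ := key B A _ _ rfl rfl (by rwa [inf_comm])
  -- `w` is strict on `R₁` only and `u` on `R₂` only, with opposite signs, so the difference is
  -- strict on both.
  refine ⟨w - u, fun m hm => ?_, fun m hm => ?_, fun m hm hm' => ?_, fun m hm hm' => ?_⟩ <;>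
    rw [AddMonoidHom.sub_apply]
  · linarith [w1 m hm, u2 m hm]
  · linarith [w2 m hm, u1 m hm]
  · linarith [w3 m hm hm', u2 m hm]
  · linarith [u3 m hm hm', w2 m hm]

/-! ### Duality for toric monoids. -/

section Toric

variable {P Q : Type*} [AddCommMonoid P] [AddCommMonoid Q]

/-- If `na = nb`, saturation gives `a = b + d`, then `nd = 0` and `d = 0`. So `P` is an affine
monoid and sits in a lattice. -/
theorem IsToric.exists_embedding (hP : IsToric P) :
    ∃ (n : ℕ) (j : P →+ (Fin n → ℤ)), Function.Injective j := by
  let _ : AddCancelCommMonoid P :=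
    { (inferInstance : AddCommMonoid P) with
      add_left_cancel := fun a b c h => hP.integral b c a (by rwa [add_comm b, add_comm c]) }
  have := hP.fg
  have : IsAddTorsionFree P := ⟨fun n hn a b h => by
    obtain ⟨d, rfl⟩ := hP.saturated n a b 0 hn (by simpa using h)
    have h1 : n • d = 0 := hP.integral _ _ (n • b) (by
      have h : n • (b + d) = n • b := h
      rw [zero_add, add_comm, ← smul_add, h])
    rw [hP.torsion_free n d hn h1, add_zero]⟩
  refine ⟨AffineAddMonoid.dim P, ((Finsupp.coeFnAddHom).comp
    (FreeAbelianGroup.toFinsupp)).comp (AffineAddMonoid.embedding P), ?_⟩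
  exact (DFunLike.coe_injective.comp
    (FreeAbelianGroup.equivFinsupp _).injective).comp AffineAddMonoid.embedding_injective

theorem exists_dual_embedding (hQ : AddMonoid.FG Q) :
    ∃ (s : Finset Q) (j : Dual Q →+ (s → ℤ)), Function.Injective j := by
  obtain ⟨s, hs⟩ := hQ.fg_top
  refine ⟨s, ⟨⟨fun m q => m q, by ext; simp⟩, fun m n => by ext; simp⟩, fun m n h => ?_⟩
  refine AddMonoidHom.eq_of_eqOn_denseM hs fun q hq => ?_
  have : (m q : ℤ) = n q := congrFun h ⟨q, hq⟩
  exact_mod_cast this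

/-- A homomorphism to `ℤ` with nonnegative values, as a homomorphism to `ℕ`. -/
def natHom (w : P →+ ℤ) (hw : ∀ p, 0 ≤ w p) : Dual P where
  toFun p := (w p).toNat
  map_zero' := by simp
  map_add' p q := by rw [map_add, Int.toNat_add (hw p) (hw q)]

theorem natHom_apply (w : P →+ ℤ) (hw : ∀ p, 0 ≤ w p) (p : P) : (natHom w hw p : ℤ) = w p :=
  Int.toNat_of_nonneg (hw p)

/-- A toric monoid is determined by the inequalities that come from its dual. -/
theorem IsToric.exists_eq_add (hP : IsToric P) {a b : P} (h : ∀ w : Dual P, w b ≤ w a) :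
    ∃ d, a = b + d := by
  classical
  obtain ⟨n, j, hj⟩ := hP.exists_embedding
  obtain ⟨s, hs⟩ := hP.fg.fg_top
  -- With `B` empty `r₂ = 0`, so `k a = k b + r₁`, and saturation removes the factor `k`.
  obtain ⟨k, hk, r₁, -, r₂, hr₂, he⟩ := exists_nsmul_add_eq j hj s ∅ b a (fun w hw _ => by
    have hw' : ∀ p, 0 ≤ w p := fun p => nonneg_of_mem_closure w hw p (hs ▸ AddSubmonoid.mem_top p)
    have := h (natHom w hw')
    rw [← natHom_apply w hw', ← natHom_apply w hw']
    exact_mod_cast this)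
  rw [Finset.coe_empty, AddSubmonoid.closure_empty, AddSubmonoid.mem_bot] at hr₂
  subst hr₂
  exact hP.saturated k a b r₁ hk.ne' (by rw [he, add_zero])

/-- Summands of an element of a face lie in the face, so those generators of `P` that lie in `F`
generate `F`. -/
theorem IsFace.fg {F : AddSubmonoid P} (hF : IsFace F ⊤) (hP : AddMonoid.FG P) : F.FG := by
  classical
  obtain ⟨s, hs⟩ := hP.fg_top
  refine ⟨s.filter (· ∈ F), le_antisymm (AddSubmonoid.closure_le.2 fun a ha => ?_) fun a ha => ?_⟩
  · exact (Finset.mem_filter.1 ha).2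
  · have h1 : a ∈ AddSubmonoid.closure (s : Set P) := hs ▸ AddSubmonoid.mem_top a
    revert ha
    refine AddSubmonoid.closure_induction (motive := fun a _ => a ∈ F → a ∈ AddSubmonoid.closure
      ((s.filter (· ∈ F) : Finset P) : Set P)) (fun a ha haF => ?_) (fun _ => zero_mem _)
      (fun a b _ _ iha ihb hab => ?_) h1
    · exact AddSubmonoid.subset_closure (Finset.mem_filter.2 ⟨ha, haF⟩)
    · have := hF.2 a (AddSubmonoid.mem_top a) b (AddSubmonoid.mem_top b) hab
      exact add_mem (iha this.1) (ihb this.2)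

/-- Every face of a toric monoid is the zero set of an element of the dual monoid. -/
theorem IsToric.exists_dual_eq_zero_iff (hP : IsToric P) {F : AddSubmonoid P} (hF : IsFace F ⊤) :
    ∃ w : Dual P, ∀ p, w p = 0 ↔ p ∈ F := by
  obtain ⟨n, j, hj⟩ := hP.exists_embedding
  -- Separate `P` itself from its face `F`: the functional is nonnegative on `P`, zero on `F` and
  -- positive elsewhere.
  obtain ⟨w, h1, h2, h3, -⟩ := exists_separating j hj hP.fg.fg_top (hF.fg hP.fg)
    (by rwa [top_inf_eq]) (by rw [top_inf_eq]; exact ⟨le_rfl, fun a ha b hb _ => ⟨ha, hb⟩⟩)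
  have hw : ∀ p, 0 ≤ w p := fun p => h1 p (AddSubmonoid.mem_top p)
  refine ⟨natHom w hw, fun p => ?_⟩
  have h4 := natHom_apply w hw p
  constructor
  · intro h
    by_contra hp
    have := h3 p (AddSubmonoid.mem_top p) hp
    omega
  · intro hp
    have := h2 p hp
    have := hw p
    omega

theorem dual_eq_zero_of_isAddUnit (w : Dual P) {p : P} (hp : IsAddUnit p) : w p = 0 := by
  obtain ⟨u, rfl⟩ := hp
  have h : w (u : P) + w ((-u : AddUnits P) : P) = 0 := by rw [← map_add]; simp
  omega

theorem isFace_isAddUnit : IsFace (IsAddUnit.addSubmonoid P) ⊤ :=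
  ⟨le_top, fun a _ b _ h => by
    change IsAddUnit (a + b) at h
    exact IsAddUnit.add_iff.1 h⟩

/-- There is an element of the dual of a toric monoid that is positive away from the units. -/
theorem IsToric.exists_dual_eq_zero_iff_isAddUnit (hP : IsToric P) :
    ∃ w : Dual P, ∀ p, w p = 0 ↔ IsAddUnit p :=
  hP.exists_dual_eq_zero_iff isFace_isAddUnit

/-- The elements of a toric monoid are determined by their values on the dual monoid and their
unit part. -/
theorem Splitting.eq_of_eval_eq (hQ : IsToric Q) (σ : Splitting Q) {a b : Q}
    (h : ∀ m : Dual Q, m a = m b) (hσ : σ.retract a = σ.retract b) : a = b := by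
  obtain ⟨d, rfl⟩ := hQ.exists_eq_add (a := a) (b := b) fun w => (h w).ge
  have hd : IsAddUnit d := by
    obtain ⟨w, hw⟩ := hQ.exists_dual_eq_zero_iff_isAddUnit
    have := h w
    rw [map_add] at this
    exact (hw d).1 (by omega)
  obtain ⟨u, rfl⟩ := hd
  rw [map_add, σ.retract_coe, add_eq_left] at hσ
  rw [hσ, AddUnits.val_zero, add_zero]

/-- The evaluation homomorphism `Q → Hom(Q^∨; ℤ)`. -/
def evalInt (Q : Type*) [AddCommMonoid Q] : Q →+ (Dual Q →+ ℤ) where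
  toFun q := (Nat.castAddMonoidHom ℤ).comp (AddMonoidHom.eval q)
  map_zero' := by ext; simp
  map_add' a b := by ext; simp

/-- If `w : Q → ℤ` kills the units and `w₀ : Q → ℕ` is positive away from them, then `w + k w₀` is
an element of `Q^∨` for some `k`. -/
theorem exists_dual_eq_add_nsmul (hQ : AddMonoid.FG Q) {w₀ : Dual Q}
    (hw₀ : ∀ q, w₀ q = 0 ↔ IsAddUnit q) (w : Q →+ ℤ) (hw : ∀ q, IsAddUnit q → w q = 0) :
    ∃ (k : ℕ) (m : Dual Q), ∀ q, (m q : ℤ) = w q + k * w₀ q := by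
  classical
  obtain ⟨s, hs⟩ := hQ.fg_top
  let k : ℕ := ∑ q ∈ s, (w q).natAbs
  let W : Q →+ ℤ := w + k • (Nat.castAddMonoidHom ℤ).comp w₀
  have hW : ∀ q, W q = w q + k * w₀ q := fun q => by simp [W]
  have hWs : ∀ q, 0 ≤ W q := fun q => nonneg_of_mem_closure W (A := s) (fun q hq => by
    rw [hW]
    have h1 : (w q).natAbs ≤ k :=
      Finset.single_le_sum (f := fun q => (w q).natAbs) (fun _ _ => Nat.zero_le _) hq
    by_cases hu : IsAddUnit q
    · rw [hw q hu]; positivity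
    · have h2 : 1 ≤ w₀ q := Nat.one_le_iff_ne_zero.2 fun h => hu ((hw₀ q).1 h)
      have h3 : k * 1 ≤ k * w₀ q := Nat.mul_le_mul_left k h2
      have h4 : (k : ℤ) ≤ k * w₀ q := by exact_mod_cast (by simpa using h3)
      omega) q (hs ▸ AddSubmonoid.mem_top q)
  exact ⟨k, natHom W hWs, fun q => by rw [natHom_apply, hW]⟩

/-- Every homomorphism `Q^∨ → ℤ` is the difference of two evaluations. -/
theorem IsToric.exists_eq_eval_sub_eval (hQ : IsToric Q) (s : Dual Q →+ ℤ) :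
    ∃ a b : Q, ∀ m : Dual Q, s m = (m a : ℤ) - m b := by
  obtain ⟨w₀, hw₀⟩ := hQ.exists_dual_eq_zero_iff_isAddUnit
  obtain ⟨G, hG⟩ := hQ.fg.fg_top
  -- `E` is the group spanned by the evaluations. It is finitely generated and torsion free, hence
  -- reflexive.
  let E : AddSubgroup (Dual Q →+ ℤ) := AddSubgroup.closure (evalInt Q '' G)
  have hE : ∀ q, evalInt Q q ∈ E := fun q =>
    AddSubmonoid.closure_induction (motive := fun q _ => evalInt Q q ∈ E)
      (fun q hq => AddSubgroup.subset_closure ⟨q, hq, rfl⟩) (by rw [map_zero]; exact zero_mem E)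
      (fun a b _ _ ha hb => by rw [map_add]; exact add_mem ha hb) (hG ▸ AddSubmonoid.mem_top q)
  have hEmem : ∀ e ∈ E, ∃ a b : Q, e = evalInt Q a - evalInt Q b := fun e he => by
    refine AddSubgroup.closure_induction
      (p := fun e _ => ∃ a b : Q, e = evalInt Q a - evalInt Q b) ?_ ⟨0, 0, by simp⟩ ?_ ?_ he
    · rintro _ ⟨q, -, rfl⟩
      exact ⟨q, 0, by simp⟩
    · rintro _ _ _ _ ⟨a, b, rfl⟩ ⟨c, d, rfl⟩
      exact ⟨a + c, b + d, by simp only [map_add]; abel⟩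
    · rintro _ _ ⟨a, b, rfl⟩
      exact ⟨b, a, by abel⟩
  let ev : Q → E := fun q => ⟨evalInt Q q, hE q⟩
  have hev : ∀ a b, ev (a + b) = ev a + ev b := fun a b => Subtype.ext (map_add (evalInt Q) a b)
  have hfin : Module.Finite ℤ E := by
    classical
    exact Module.Finite.iff_addGroup_fg.2 ((AddGroup.fg_iff_addSubgroup_fg E).2
      ⟨G.image (evalInt Q), by rw [Finset.coe_image]⟩)
  have htf : Module.IsTorsionFree ℤ E := by
    refine ⟨fun r hr a b h => Subtype.ext (AddMonoidHom.ext fun m => ?_)⟩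
    have : r * (a : Dual Q →+ ℤ) m = r * (b : Dual Q →+ ℤ) m :=
      congrArg (fun e : E => (e : Dual Q →+ ℤ) m) h
    exact mul_left_cancel₀ hr.ne_zero this
  have hrefl : Module.IsReflexive ℤ E := inferInstance
  -- the restriction of functionals on `E` to `Q` kills the units
  have hres : ∀ w : E →ₗ[ℤ] ℤ, ∃ (k : ℕ) (m : Dual Q), ∀ q, (m q : ℤ) = w (ev q) + k * w₀ q :=
    fun w => exists_dual_eq_add_nsmul hQ.fg hw₀
      ⟨⟨fun q => w (ev q), by
        have : ev 0 = 0 := Subtype.ext (map_zero (evalInt Q))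
        rw [this, map_zero]⟩, fun a b => by dsimp only; rw [hev, map_add]⟩ fun q hq => by
        have : ev q = 0 := Subtype.ext (by
          ext m
          change (m q : ℤ) = 0
          rw [dual_eq_zero_of_isAddUnit m hq, Nat.cast_zero])
        change w (ev q) = 0
        rw [this, map_zero]
  choose k m hm using hres
  -- Functionals on `E` have the form `m - k w₀` with `m ∈ Q^∨`, so `s` extends to them by `s(m) - k
  -- s(w₀)`. By reflexivity this extension is evaluation at an element of `E`.
  let S : Module.Dual ℤ E →+ ℤ :=
    { toFun := fun w => s (m w) - k w * s w₀
      map_zero' := by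
        have : m 0 = k 0 • w₀ := by
          ext q
          have := hm 0 q
          rw [LinearMap.zero_apply, zero_add] at this
          exact_mod_cast this
        rw [this, map_nsmul]; simp
      map_add' := fun v w => by
        have : m (v + w) + (k v + k w) • w₀ = m v + m w + k (v + w) • w₀ := by
          ext q
          have h1 := hm (v + w) q
          have h2 := hm v q
          have h3 := hm w q
          rw [LinearMap.add_apply] at h1
          zify
          simp only [AddMonoidHom.add_apply, AddMonoidHom.nsmul_apply, smul_eq_mul]
          push_cast
          linarith
        have := congrArg s this
        simp only [map_add, map_nsmul, nsmul_eq_mul] at this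
        push_cast at this
        linarith }
  obtain ⟨e, he⟩ := (Module.evalEquiv ℤ E).surjective S.toIntLinearMap
  obtain ⟨a, b, hab⟩ := hEmem e e.2
  refine ⟨a, b, fun n => ?_⟩
  let N : E →ₗ[ℤ] ℤ := ((AddMonoidHom.eval n).comp E.subtype).toIntLinearMap
  have hN : m N = n + k N • w₀ := by
    ext q
    have := hm N q
    have h2 : N (ev q) = n q := rfl
    rw [h2] at this
    zify
    simpa using this
  have h1 : S N = s n := by
    change s (m N) - k N * s w₀ = _
    rw [hN, map_add, map_nsmul]; simp
  have h2 : S N = N e := by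
    have := congrArg (fun T => T N) he
    exact this.symm
  rw [← h1, h2]
  change (e : Dual Q →+ ℤ) n = _
  rw [hab]
  rfl

end Toric

/-! ### Faces and the members of a refinement. -/

section Faces

variable {M : Type*} [AddCommMonoid M]

/-- Every element of a monoid lies in the interior of one of its faces. -/
theorem exists_isFace_mem_interior {R : AddSubmonoid M} {m : M} (hm : m ∈ R) :
    ∃ T, IsFace T R ∧ m ∈ monoidInterior T := by
  -- The smallest face containing `m`: the elements of `R` that are summands in `R` of some multiple
  -- of `m`.
  let T : AddSubmonoid M :=
    { carrier := {a | a ∈ R ∧ ∃ b ∈ R, ∃ n : ℕ, a + b = n • m}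
      zero_mem' := ⟨zero_mem _, 0, zero_mem _, 0, by simp⟩
      add_mem' := by
        rintro a a' ⟨ha, b, hb, n, h⟩ ⟨ha', b', hb', n', h'⟩
        exact ⟨add_mem ha ha', b + b', add_mem hb hb', n + n', by
          rw [add_smul, ← h, ← h']; abel⟩ }
  have hT : IsFace T R := by
    refine ⟨fun a ha => ha.1, ?_⟩
    rintro a ha b hb ⟨-, c, hc, n, h⟩
    exact ⟨⟨ha, b + c, add_mem hb hc, n, by rw [← h]; abel⟩,
      ⟨hb, a + c, add_mem ha hc, n, by rw [← h]; abel⟩⟩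
  have hmT : m ∈ T := ⟨hm, 0, zero_mem _, 1, by simp⟩
  refine ⟨T, hT, hmT, fun S hS hmS => le_antisymm hS.1 ?_⟩
  rintro a ⟨ha, b, hb, n, h⟩
  exact (hS.2 a ⟨ha, b, hb, n, h⟩ b ⟨hb, a, ha, n, by rw [← h, add_comm]⟩
    (h ▸ nsmul_mem hmS n)).1

/-- Two members of a refinement meet in a common face. -/
theorem Refinement.isFace_inf (𝓡 : Refinement M) {R₁ R₂ : AddSubmonoid M} (h₁ : R₁ ∈ 𝓡.cones)
    (h₂ : R₂ ∈ 𝓡.cones) : IsFace (R₁ ⊓ R₂) R₁ := by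
  refine ⟨inf_le_left, fun a ha b hb hab => ?_⟩
  obtain ⟨T₁, hT₁, hm₁⟩ := exists_isFace_mem_interior hab.1
  obtain ⟨T₂, hT₂, hm₂⟩ := exists_isFace_mem_interior hab.2
  -- The faces of `R₁` and `R₂` with `a + b` in their interior are members of the refinement, hence
  -- equal; this face contains `a` and `b`.
  have h := (𝓡.partition (a + b)).unique ⟨𝓡.face_mem _ h₁ _ hT₁, hm₁⟩ ⟨𝓡.face_mem _ h₂ _ hT₂, hm₂⟩
  have h3 := hT₁.2 a ha b hb hm₁.1
  exact ⟨⟨ha, hT₂.1 (h ▸ h3.1)⟩, ⟨hb, hT₂.1 (h ▸ h3.2)⟩⟩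

/-- Two members of a refinement of a dual monoid are separated by a functional that vanishes only
on their intersection. -/
theorem Refinement.exists_separating {Q : Type*} [AddCommMonoid Q] (hQ : AddMonoid.FG Q)
    (𝓡 : Refinement (Dual Q)) {R₁ R₂ : AddSubmonoid (Dual Q)} (h₁ : R₁ ∈ 𝓡.cones)
    (h₂ : R₂ ∈ 𝓡.cones) :
    ∃ w : Dual Q →+ ℤ, (∀ m ∈ R₁, 0 ≤ w m) ∧ (∀ m ∈ R₂, w m ≤ 0) ∧
      (∀ m ∈ R₁, m ∉ R₂ → 0 < w m) ∧ (∀ m ∈ R₂, m ∉ R₁ → w m < 0) := by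
  obtain ⟨s, j, hj⟩ := exists_dual_embedding hQ
  exact GenCorners.exists_separating j hj ((AddMonoid.fg_iff_addSubmonoid_fg _).1 (𝓡.toric _ h₁).fg)
    ((AddMonoid.fg_iff_addSubmonoid_fg _).1 (𝓡.toric _ h₂).fg) (𝓡.isFace_inf h₁ h₂)
    (inf_comm R₁ R₂ ▸ 𝓡.isFace_inf h₂ h₁)

/-- Adding a large multiple of a functional that is positive on `R` away from `S` makes a functional
that is nonnegative on `S` nonnegative on `R`. -/
theorem exists_add_nsmul_mem_dualCone {R : AddSubmonoid M} (hR : R.FG) (S : AddSubmonoid M)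
    {w t : M →+ ℤ} (hw : ∀ m ∈ R, 0 ≤ w m) (hw' : ∀ m ∈ R, m ∉ S → 0 < w m)
    (ht : ∀ m ∈ S, 0 ≤ t m) : ∃ k : ℕ, t + k • w ∈ dualCone R := by
  classical
  obtain ⟨s, rfl⟩ := hR
  refine ⟨∑ m ∈ s, (t m).natAbs, nonneg_of_mem_closure _ fun m hm => ?_⟩
  have h1 : (t m).natAbs ≤ ∑ m ∈ s, (t m).natAbs :=
    Finset.single_le_sum (f := fun m => (t m).natAbs) (fun _ _ => Nat.zero_le _) hm
  have hmR := AddSubmonoid.subset_closure (s := (s : Set M)) hm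
  rw [AddMonoidHom.add_apply, AddMonoidHom.nsmul_apply, nsmul_eq_mul]
  generalize (∑ m ∈ s, (t m).natAbs) = k at h1
  by_cases hS : m ∈ S
  · exact add_nonneg (ht m hS) (mul_nonneg (by positivity) (hw m hmR))
  · have h2 := hw' m hmR hS
    have h3 : (k : ℤ) * 1 ≤ k * w m := mul_le_mul_of_nonneg_left h2 (by positivity)
    omega

end Faces

/-! ### Continuity and closure properties of smooth functions and b-maps. -/

section Smooth

variable {P Q : Type*} [AddCommMonoid P] [AddCommMonoid Q]

namespace ModelSpace

theorem continuous_eval (p : P) : Continuous fun x : ModelSpace P => x p :=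
  (continuous_apply p).comp continuous_induced_dom

theorem continuousOn_iff {X : Type*} [TopologicalSpace X] {O : Set X} {f : X → ModelSpace P} :
    ContinuousOn f O ↔ ∀ p, ContinuousOn (fun x => f x p) O := by
  refine ⟨fun h p => (continuous_eval p).comp_continuousOn h, fun h => ?_⟩
  exact (Topology.IsInducing.continuousOn_iff ⟨rfl⟩).2 (continuousOn_pi.2 h)

theorem continuous_iff {X : Type*} [TopologicalSpace X] {f : X → ModelSpace P} :
    Continuous f ↔ ∀ p, Continuous fun x => f x p := by
  simp only [← continuousOn_univ, continuousOn_iff]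

theorem map_nsmul (x : ModelSpace P) (n : ℕ) (p : P) : x (n • p) = x p ^ n := by
  induction n with
  | zero => rw [zero_smul, pow_zero, x.map_zero']
  | succ n ih => rw [succ_nsmul, x.map_add', ih, pow_succ]

theorem ne_zero_of_isAddUnit (x : ModelSpace P) {p : P} (hp : IsAddUnit p) : x p ≠ 0 := by
  obtain ⟨u, rfl⟩ := hp
  intro h
  have h1 : x (u : P) * x ((-u : AddUnits P) : P) = 1 := by
    rw [← x.map_add', AddUnits.add_neg, x.map_zero']
  rw [h, zero_mul] at h1
  exact zero_ne_one h1

theorem ne_zero_iff_of_mem_minFace {x : ModelSpace P} (hx : x ∈ minFace P) {p : P} :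
    x p ≠ 0 ↔ IsAddUnit p :=
  ⟨fun h => by_contra fun hp => h (hx p hp), x.ne_zero_of_isAddUnit⟩

/-- The point of a model space all of whose coordinates are `1`. -/
instance : Inhabited (ModelSpace P) := ⟨⟨fun _ => 1, rfl, fun _ _ => (one_mul 1).symm⟩⟩

end ModelSpace

theorem continuous_coords {n : ℕ} (p : Fin n → P) : Continuous (coords p) :=
  continuous_pi fun i => NNReal.continuous_coe.comp (ModelSpace.continuous_eval (p i))

theorem IsSmoothOn.continuousOn {O : Set (ModelSpace P)} {f : ModelSpace P → ℝ}
    (hf : IsSmoothOn O f) : ContinuousOn f O := by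
  obtain ⟨n, p, g, hg, hfg⟩ := hf
  intro x hx
  obtain ⟨V, hV, hxV, G, hG, hE⟩ := hg _ (mem_image_of_mem _ hx)
  have h1 : ContinuousAt (fun y => G (coords p y)) x :=
    ContinuousAt.comp (f := coords p) (hG.continuousOn.continuousAt (hV.mem_nhds hxV))
      (continuous_coords p).continuousAt
  have hEq : ∀ y ∈ O, coords p y ∈ V → f y = G (coords p y) := fun y hy hyV => by
    rw [hfg y hy, hE ⟨mem_image_of_mem _ hy, hyV⟩]
  refine h1.continuousWithinAt.congr_of_eventuallyEq ?_ (hEq x hx hxV)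
  have h2 : ∀ᶠ y in 𝓝[O] x, coords p y ∈ V :=
    mem_nhdsWithin_of_mem_nhds ((continuous_coords p).continuousAt (hV.mem_nhds hxV))
  filter_upwards [self_mem_nhdsWithin, h2] with y hy hyV using hEq y hy hyV

theorem IsSmoothPosOn.continuousOn {O : Set (ModelSpace P)} {h : ModelSpace P → ℝ≥0}
    (hh : IsSmoothPosOn O h) : ContinuousOn h O :=
  NNReal.isEmbedding_coe.continuousOn_iff.2 hh.1.continuousOn

theorem IsSmoothPosOn.inv {O : Set (ModelSpace P)} {h : ModelSpace P → ℝ≥0}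
    (hh : IsSmoothPosOn O h) : IsSmoothPosOn O fun x => (h x)⁻¹ := by
  obtain ⟨⟨n, p, g, hg, hgf⟩, hpos⟩ := hh
  refine ⟨⟨n, p, fun w => (g w)⁻¹, ?_, fun x hx => ?_⟩, fun x hx => inv_pos.2 (hpos x hx)⟩
  · rintro _ ⟨x, hx, rfl⟩
    obtain ⟨V, hV, hxV, G, hG, hE⟩ := hg _ (mem_image_of_mem _ hx)
    refine ⟨V ∩ G ⁻¹' {0}ᶜ, hG.continuousOn.isOpen_inter_preimage hV isOpen_compl_singleton,
      ⟨hxV, ?_⟩, fun w => (G w)⁻¹, (hG.mono inter_subset_left).inv fun w hw => hw.2, ?_⟩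
    · rw [mem_preimage, ← hE ⟨mem_image_of_mem _ hx, hxV⟩, ← hgf x hx]
      exact fun h0 => (hpos x hx).ne' (NNReal.coe_eq_zero.1 h0)
    · rintro w ⟨hw, hwV, -⟩
      dsimp only
      rw [hE ⟨hw, hwV⟩]
  · exact (NNReal.coe_inv _).trans (congrArg _ (hgf x hx))

theorem IsSmoothPosOn.pow {O : Set (ModelSpace P)} {h : ModelSpace P → ℝ≥0}
    (hh : IsSmoothPosOn O h) (k : ℕ) : IsSmoothPosOn O fun x => h x ^ k := by
  induction k with
  | zero => simpa using IsSmoothPosOn.one O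
  | succ k ih => simpa only [pow_succ] using ih.mul hh

theorem IsSmoothPosOn.coord {O : Set (ModelSpace P)} {p : P} (hp : ∀ x ∈ O, 0 < x p) :
    IsSmoothPosOn O fun x => x p :=
  ⟨⟨1, fun _ => p, fun w => w 0, fun w _ => ⟨univ, isOpen_univ, mem_univ _, fun w => w 0,
    by fun_prop, fun _ _ => rfl⟩, fun _ _ => rfl⟩, hp⟩

theorem IsInteriorBMapOn.continuousOn {O : Set (ModelSpace P)}
    {f : ModelSpace P → ModelSpace Q} (hf : IsInteriorBMapOn O f) : ContinuousOn f O := by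
  refine ModelSpace.continuousOn_iff.2 fun q => ?_
  obtain ⟨p, h, hh, hfq⟩ := hf q
  exact (hh.continuousOn.mul (ModelSpace.continuous_eval p).continuousOn).congr hfq

/-- The positive factor `h` cannot create zeros. This permits cancelling coordinates of `f` on the
dense set of points with nonzero coordinates. -/
theorem IsInteriorBMapOn.ne_zero {O : Set (ModelSpace P)}
    {f : ModelSpace P → ModelSpace Q} (hf : IsInteriorBMapOn O f) {y : ModelSpace P} (hy : y ∈ O)
    (hy' : ∀ p, y p ≠ 0) (q : Q) : f y q ≠ 0 := by
  obtain ⟨p, h, hh, hfq⟩ := hf q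
  rw [hfq y hy]
  exact mul_ne_zero (hh.2 y hy).ne' (hy' p)

end Smooth

/-! ### Curves into the boundary, density, and normal vectors. -/

section Curves

variable {P : Type*} [AddCommMonoid P]

/-- The support of a point of a model space. -/
def support (y : ModelSpace P) : AddSubmonoid P where
  carrier := {p | y p ≠ 0}
  zero_mem' := by
    change y 0 ≠ 0
    rw [y.map_zero']
    exact one_ne_zero
  add_mem' := fun {a b} ha hb => by
    change y (a + b) ≠ 0
    rw [y.map_add']
    exact mul_ne_zero ha hb

theorem isFace_support (y : ModelSpace P) : IsFace (support y) ⊤ :=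
  ⟨le_top, fun a _ b _ h => by
    change y (a + b) ≠ 0 at h
    rw [y.map_add'] at h
    exact ⟨left_ne_zero_of_mul h, right_ne_zero_of_mul h⟩⟩

theorem grothendieck_lift_of {M G : Type*} [AddCommMonoid M] [AddCommGroup G] (f : M →+ G)
    (m : M) : Algebra.GrothendieckAddGroup.lift f (Algebra.GrothendieckAddGroup.of m) = f m := by
  change ((Algebra.GrothendieckAddGroup.lift f).comp Algebra.GrothendieckAddGroup.of) m = f m
  rw [← Algebra.GrothendieckAddGroup.lift_symm_apply, Equiv.symm_apply_apply]

/-- The nonvanishing coordinates of a point extend to a point all of whose coordinates are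
nonzero. -/
theorem IsToric.exists_extension (hP : IsToric P) (y : ModelSpace P) :
    ∃ z : ModelSpace P, (∀ p, z p ≠ 0) ∧ ∀ p, y p ≠ 0 → z p = y p := by
  have : IsCancelAdd P :=
    { add_left_cancel := fun a b c h => hP.integral b c a
        ((add_comm b a).trans (h.trans (add_comm a c)))
      add_right_cancel := fun a b c h => hP.integral b c a h }
  let F := support y
  let ψ : F →+ Algebra.GrothendieckAddGroup P :=
    (Algebra.GrothendieckAddGroup.of (M := P)).comp F.subtype
  let i := Algebra.GrothendieckAddGroup.lift ψ
  have hi_of : ∀ a : F, i (Algebra.GrothendieckAddGroup.of a) = Algebra.GrothendieckAddGroup.of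
      (a : P) := grothendieck_lift_of ψ
  have hi : Function.Injective i := by
    refine (injective_iff_map_eq_zero i).2 fun g hg => ?_
    obtain ⟨⟨a, b⟩, hab⟩ := (AddLocalization.addMonoidOf (⊤ : AddSubmonoid F)).surj g
    have hab : g + Algebra.GrothendieckAddGroup.of (b : F) = Algebra.GrothendieckAddGroup.of a :=
      hab
    have h1 := congrArg i hab
    rw [map_add, hg, zero_add, hi_of, hi_of] at h1
    have h2 : (b : F) = a := Subtype.ext (Algebra.GrothendieckAddGroup.of_injective h1)
    rw [h2] at hab
    exact add_eq_right.1 hab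
  let log : F →+ ℝ :=
    { toFun := fun p => Real.log (y p)
      map_zero' := by
        rw [ZeroMemClass.coe_zero, y.map_zero', NNReal.coe_one, Real.log_one]
      map_add' := fun a b => by
        rw [AddMemClass.coe_add, y.map_add', NNReal.coe_mul,
          Real.log_mul (NNReal.coe_ne_zero.2 a.2) (NNReal.coe_ne_zero.2 b.2)] }
  -- The group completion of the support embeds in that of `P`, and `ℝ` is divisible, so the
  -- logarithm of `y` extends; `z` is its exponential.
  obtain ⟨L, hL⟩ := (Module.Baer.of_divisible (A := ℝ)).extension_property_addMonoidHom i hi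
    (Algebra.GrothendieckAddGroup.lift log)
  let l : P →+ ℝ := L.comp Algebra.GrothendieckAddGroup.of
  have hl : ∀ p (hp : y p ≠ 0), l p = Real.log (y p) := fun p hp => by
    have h1 := DFunLike.congr_fun hL (Algebra.GrothendieckAddGroup.of (⟨p, hp⟩ : F))
    rw [AddMonoidHom.comp_apply, hi_of] at h1
    rw [grothendieck_lift_of] at h1
    exact h1
  clear_value l
  have hmul : ∀ p q, (Real.exp (l (p + q))).toNNReal =
      (Real.exp (l p)).toNNReal * (Real.exp (l q)).toNNReal := fun p q => by
    rw [map_add, Real.exp_add, Real.toNNReal_mul (Real.exp_pos _).le]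
  refine ⟨⟨fun p => (Real.exp (l p)).toNNReal, by rw [map_zero, Real.exp_zero, Real.toNNReal_one],
    hmul⟩, fun p => (Real.toNNReal_pos.2 (Real.exp_pos _)).ne', fun p hp => ?_⟩
  change (Real.exp (l p)).toNNReal = y p
  rw [hl p hp, Real.exp_log (NNReal.coe_pos.2 (pos_iff_ne_zero.2 hp)), Real.toNNReal_coe]

/-- The curve `t ↦ (p ↦ z_p t^{w(p)})` in a model space. -/
def curve (z : ModelSpace P) (w : Dual P) (t : ℝ≥0) : ModelSpace P where
  toFun p := z p * t ^ w p
  map_zero' := by rw [z.map_zero', map_zero, pow_zero, mul_one]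
  map_add' p q := by rw [z.map_add', map_add, pow_add]; ring

theorem continuous_curve (z : ModelSpace P) (w : Dual P) : Continuous (curve z w) :=
  ModelSpace.continuous_iff.2 fun p => continuous_const.mul (continuous_pow (w p))

/-- Since `0 ^ 0 = 1`, the curve keeps at `t = 0` exactly the coordinates with `w(p) = 0`, which are
those on the support of `y`. -/
theorem curve_zero {y z : ModelSpace P} {w : Dual P} (hz : ∀ p, y p ≠ 0 → z p = y p)
    (hw : ∀ p, w p = 0 ↔ y p ≠ 0) : curve z w 0 = y := by
  ext p : 2
  change z p * 0 ^ w p = y p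
  by_cases hp : y p = 0
  · rw [hp, zero_pow (fun h => (hw p).1 h hp), mul_zero]
  · rw [hz p hp, (hw p).2 hp, pow_zero, mul_one]

/-- The points with nonzero coordinates are dense in the model space of a toric monoid. -/
theorem IsToric.dense_interior (hP : IsToric P) : Dense {y : ModelSpace P | ∀ p, y p ≠ 0} := by
  intro y
  obtain ⟨z, hz, hzy⟩ := hP.exists_extension y
  obtain ⟨w, hw⟩ := hP.exists_dual_eq_zero_iff (isFace_support y)
  have h0 : Tendsto (curve z w) (𝓝[>] 0) (𝓝 y) := by
    have := (continuous_curve z w).tendsto 0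
    rw [curve_zero hzy hw] at this
    exact this.mono_left nhdsWithin_le_nhds
  refine mem_closure_of_tendsto h0 ?_
  filter_upwards [self_mem_nhdsWithin] with t ht p
  exact mul_ne_zero (hz p) (pow_ne_zero _ (ne_of_gt ht))

/-- Continuous maps on an open set are determined by their values at points with nonzero
coordinates. -/
theorem IsToric.eqOn_of_interior (hP : IsToric P) {X : Type*} [TopologicalSpace X] [T2Space X]
    {O : Set (ModelSpace P)} (hO : IsOpen O) {u v : ModelSpace P → X} (hu : ContinuousOn u O)
    (hv : ContinuousOn v O) (h : ∀ y ∈ O, (∀ p, y p ≠ 0) → u y = v y) : EqOn u v O :=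
  EqOn.of_subset_closure (s := O ∩ {y | ∀ p, y p ≠ 0}) (fun y hy => h y hy.1 hy.2) hu hv
    inter_subset_left (hP.dense_interior.open_subset_closure_inter hO)

/-- Compare orders of vanishing on the curve `z_p t^{w(p)}` ending at `x`. If `w(p) < w(p')`,
dividing by `t^{w(p)}` leaves the nonzero limit `h(x) z_p` on one side and `0` on the other. -/
theorem IsToric.le_of_germ_eq (hP : IsToric P) {x : ModelSpace P} (hx : x ∈ ModelSpace.minFace P)
    {h h' : ModelSpace P → ℝ≥0} (hc : ContinuousAt h x) (hc' : ContinuousAt h' x) (h0 : h x ≠ 0)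
    {p p' : P} (he : ∀ᶠ y in 𝓝 x, h y * y p = h' y * y p') {w : Dual P}
    (hw : ∀ p, w p = 0 ↔ IsAddUnit p) : w p' ≤ w p := by
  by_contra! hlt
  obtain ⟨z, hz, hzx⟩ := hP.exists_extension x
  have hγ0 : curve z w 0 = x := curve_zero hzx fun p => by
    rw [hw p, ModelSpace.ne_zero_iff_of_mem_minFace hx]
  have hγ : Tendsto (curve z w) (𝓝[>] 0) (𝓝 x) := by
    have := (continuous_curve z w).tendsto 0
    rw [hγ0] at this
    exact this.mono_left nhdsWithin_le_nhds
  obtain ⟨d, hd⟩ := Nat.exists_eq_add_of_lt hlt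
  have h1 : Tendsto (fun t => h (curve z w t) * z p) (𝓝[>] 0) (𝓝 (h x * z p)) :=
    (hc.tendsto.comp hγ).mul tendsto_const_nhds
  have h2 : Tendsto (fun t : ℝ≥0 => h' (curve z w t) * (z p' * t ^ (d + 1))) (𝓝[>] 0)
      (𝓝 (h' x * (z p' * 0 ^ (d + 1)))) :=
    (hc'.tendsto.comp hγ).mul (tendsto_const_nhds.mul
      (((continuous_pow (d + 1)).tendsto 0).mono_left nhdsWithin_le_nhds))
  have h3 : (fun t => h (curve z w t) * z p) =ᶠ[𝓝[>] 0]
      fun t : ℝ≥0 => h' (curve z w t) * (z p' * t ^ (d + 1)) := by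
    filter_upwards [hγ.eventually he, self_mem_nhdsWithin] with t ht ht0
    have ht' : h (curve z w t) * (z p * t ^ w p) = h' (curve z w t) * (z p' * t ^ w p') := ht
    rw [hd, add_assoc, pow_add] at ht'
    refine mul_right_cancel₀ (pow_ne_zero (w p) (ne_of_gt ht0)) ?_
    linear_combination ht'
  have h4 := tendsto_nhds_unique (h1.congr' h3) h2
  rw [zero_pow (Nat.succ_ne_zero d), mul_zero, mul_zero] at h4
  exact mul_ne_zero h0 (hz p) h4

/-- At a point of the minimal boundary face, the germ of a b-function `h x_p` determines the values
at `p` of the elements of the dual monoid. -/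
theorem IsToric.eq_of_germ_eq (hP : IsToric P) {x : ModelSpace P} (hx : x ∈ ModelSpace.minFace P)
    {h h' : ModelSpace P → ℝ≥0} (hc : ContinuousAt h x) (hc' : ContinuousAt h' x) (h0 : h x ≠ 0)
    (h0' : h' x ≠ 0) {p p' : P} (he : ∀ᶠ y in 𝓝 x, h y * y p = h' y * y p') (w : Dual P) :
    w p = w p' := by
  have key : ∀ w : Dual P, (∀ p, w p = 0 ↔ IsAddUnit p) → w p = w p' := fun w hw =>
    le_antisymm (hP.le_of_germ_eq hx hc' hc h0' (he.mono fun _ h => h.symm) hw)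
      (hP.le_of_germ_eq hx hc hc' h0 he hw)
  obtain ⟨w₀, hw₀⟩ := hP.exists_dual_eq_zero_iff_isAddUnit
  have h1 := key w₀ hw₀
  -- An arbitrary `w` is the difference of `w + w₀` and `w₀`, both positive away from the units.
  have h2 := key (w + w₀) fun q => by
    rw [AddMonoidHom.add_apply, Nat.add_eq_zero_iff, hw₀]
    exact ⟨fun h => h.2, fun h => ⟨dual_eq_zero_of_isAddUnit w h, h⟩⟩
  rw [AddMonoidHom.add_apply, AddMonoidHom.add_apply] at h2
  omega

/-- At a point of the minimal boundary face, each element of `P^∨` gives a normal vector. -/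
theorem IsToric.exists_normal (hP : IsToric P) {x : ModelSpace P} (hx : x ∈ ModelSpace.minFace P)
    (w : Dual P) : ∃ v : NormalMonoid x, ∀ (b : ModelSpace P → ℝ≥0)
      (hb : (b : Germ (𝓝 x) ℝ≥0) ∈ bStalk x) (V : Set (ModelSpace P)) (p : P)
      (h : ModelSpace P → ℝ≥0), IsOpen V → x ∈ V → IsSmoothPosOn V h →
        (∀ y ∈ V, b y = h y * y p) → v (Additive.ofMul ⟨b, hb⟩) = w p := by
  have hrep : ∀ γ : bStalk x, ∃ (p : P) (h : ModelSpace P → ℝ≥0), ContinuousAt h x ∧ h x ≠ 0 ∧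
      (γ : Germ (𝓝 x) ℝ≥0) = ((fun y => h y * y p : ModelSpace P → ℝ≥0) : Germ (𝓝 x) ℝ≥0) := by
    rintro ⟨_, b, ⟨V, hV, hxV, p, h, hh, hb⟩, rfl⟩
    exact ⟨p, h, hh.continuousOn.continuousAt (hV.mem_nhds hxV), (hh.2 x hxV).ne',
      Germ.coe_eq.2 (Filter.eventually_of_mem (hV.mem_nhds hxV) hb)⟩
  choose p h hc h0 he using hrep
  -- The value `w(p)` does not depend on the chosen representation of the germ, so it is additive on
  -- germs.
  have hw : ∀ (γ : bStalk x) (q : P) (k : ModelSpace P → ℝ≥0), ContinuousAt k x → k x ≠ 0 →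
      (γ : Germ (𝓝 x) ℝ≥0) = ((fun y => k y * y q : ModelSpace P → ℝ≥0) : Germ (𝓝 x) ℝ≥0) →
      w (p γ) = w q := fun γ q k hk hk0 hγ =>
    hP.eq_of_germ_eq hx (hc γ) hk (h0 γ) hk0 (Germ.coe_eq.1 ((he γ).symm.trans hγ)) w
  refine ⟨⟨⟨fun γ => w (p γ.toMul), ?_⟩, fun γ δ => ?_⟩, fun b hb V q k hV hxV hk hbk => ?_⟩
  · rw [← map_zero w]
    refine hw _ 0 (fun _ => 1) continuousAt_const one_ne_zero ?_
    change ((fun _ => 1 : ModelSpace P → ℝ≥0) : Germ (𝓝 x) ℝ≥0) = _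
    exact congrArg _ (funext fun y => by rw [y.map_zero', mul_one])
  · dsimp only
    rw [← map_add]
    refine hw _ _ (fun y => h γ.toMul y * h δ.toMul y) ((hc _).mul (hc _))
      (mul_ne_zero (h0 _) (h0 _)) ?_
    rw [toMul_add, Submonoid.coe_mul, he γ.toMul, he δ.toMul, ← Germ.coe_mul]
    refine congrArg _ (funext fun y => ?_)
    rw [Pi.mul_apply, y.map_add']
    ring
  · exact hw _ q k (hk.continuousOn.continuousAt (hV.mem_nhds hxV)) (hk.2 x hxV).ne'
      (Germ.coe_eq.2 (Filter.eventually_of_mem (hV.mem_nhds hxV) hbk))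

end Curves

/-! ### Extending points to localizations. -/

section Extension

variable {M : Type*} [AddCommMonoid M]

theorem dualCone_anti {R S : AddSubmonoid M} (h : S ≤ R) : dualCone R ≤ dualCone S :=
  fun _ hs m hm => hs m (h hm)

theorem mem_dualCone_add_nsmul {R : AddSubmonoid M} {w t : M →+ ℤ} (hw : w ∈ dualCone R) {k : ℕ}
    (h : t + k • w ∈ dualCone R) (l : ℕ) : t + (k + l) • w ∈ dualCone R := by
  rw [add_smul, ← add_assoc]
  exact add_mem h (nsmul_mem hw l)

/-- A point of `X_{R^∨}` at which `x_w` does not vanish extends to each monoid that becomes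
contained in `R^∨` after the addition of multiples of `w`. -/
theorem ModelSpace.exists_extension_of_ne_zero {R : AddSubmonoid M} (x : ModelSpace (dualCone R))
    (w : dualCone R) (hx : x w ≠ 0) (T : AddSubmonoid (M →+ ℤ))
    (hT : ∀ t ∈ T, ∃ k : ℕ, t + k • (w : M →+ ℤ) ∈ dualCone R) :
    ∃ y : ModelSpace T, ∀ (t : T) (k : ℕ) (h : (t : M →+ ℤ) + k • (w : M →+ ℤ) ∈ dualCone R),
      y t * x w ^ k = x ⟨_, h⟩ := by
  have hT' : ∀ t : T, ∃ k : ℕ, (t : M →+ ℤ) + k • (w : M →+ ℤ) ∈ dualCone R := fun t => hT t t.2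
  choose k hk using hT'
  -- The forced value at `t` is `x(t + kw) / x(w)^k`; it is the same for every admissible `k`.
  have hindep : ∀ (t : T) (l : ℕ) (h : (t : M →+ ℤ) + l • (w : M →+ ℤ) ∈ dualCone R),
      x ⟨_, hk t⟩ * (x w ^ k t)⁻¹ * x w ^ l = x ⟨_, h⟩ := fun t l h => by
    have h1 : x ⟨_, hk t⟩ * x w ^ l = x ⟨_, h⟩ * x w ^ k t := by
      rw [← x.map_nsmul, ← x.map_nsmul, ← x.map_add', ← x.map_add']
      refine congrArg x (Subtype.ext ?_)
      simp only [AddSubmonoid.coe_add, AddSubmonoidClass.coe_nsmul]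
      abel
    have := pow_ne_zero (k t) hx
    field_simp
    rw [h1, mul_comm]
  refine ⟨⟨fun t => x ⟨_, hk t⟩ * (x w ^ k t)⁻¹, ?_, fun t u => ?_⟩, hindep⟩
  · have h0 : ((0 : T) : M →+ ℤ) + 0 • (w : M →+ ℤ) ∈ dualCone R := by simp
    have := hindep 0 0 h0
    rw [pow_zero, mul_one] at this
    rw [this, ← x.map_zero']
    exact congrArg x (Subtype.ext (by simp))
  · have h1 : ((t + u : T) : M →+ ℤ) + (k t + k u) • (w : M →+ ℤ) ∈ dualCone R := by
      rw [AddSubmonoid.coe_add, add_smul, add_add_add_comm]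
      exact add_mem (hk t) (hk u)
    have h2 := hindep (t + u) (k t + k u) h1
    have h3 : x ⟨_, h1⟩ = x ⟨_, hk t⟩ * x ⟨_, hk u⟩ := by
      rw [← x.map_add']
      refine congrArg x (Subtype.ext ?_)
      simp only [AddSubmonoid.coe_add, add_smul]
      abel
    rw [h3] at h2
    refine mul_right_cancel₀ (pow_ne_zero (k t + k u) hx) (h2.trans ?_)
    have := pow_ne_zero (k t) hx
    have := pow_ne_zero (k u) hx
    rw [pow_add]
    field_simp

end Extension

/-! ### The gluing relation and the charts of the blow-up. -/

namespace Refinement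

variable {Q : Type*} [AddCommMonoid Q] (𝓡 : Refinement (Dual Q))

/-- A closed description of the identifications: points of two charts are compatible if their
coordinates satisfy all the multiplicative relations that hold in `L^∨`. -/
def Compat (a b : Σ R : 𝓡.MaxCone, ModelSpace (dualCone R.1)) : Prop :=
  ∀ (r r' : dualCone a.1.1) (s s' : dualCone b.1.1),
    (r + s' : Dual Q →+ ℤ) = r' + s → a.2 r * b.2 s' = a.2 r' * b.2 s

variable {𝓡} {a b c : Σ R : 𝓡.MaxCone, ModelSpace (dualCone R.1)}

theorem Compat.refl : 𝓡.Compat a a := fun r r' s s' h => by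
  rw [← a.2.map_add', ← a.2.map_add']
  exact congrArg a.2 (Subtype.ext h)

theorem Compat.symm (h : 𝓡.Compat a b) : 𝓡.Compat b a := fun r r' s s' hr => by
  have := h s' s r' r (by rw [add_comm, hr, add_comm])
  rw [mul_comm, this, mul_comm]

theorem Compat.eq {R : 𝓡.MaxCone} {x y : ModelSpace (dualCone R.1)}
    (h : 𝓡.Compat ⟨R, x⟩ ⟨R, y⟩) : x = y := by
  ext r : 2
  have := h r 0 r 0 (by simp [add_comm])
  simpa [x.map_zero', y.map_zero'] using this

/-- Points that are restrictions of one point of the localization are compatible. -/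
theorem compat_of_extension {T : AddSubmonoid (Dual Q →+ ℤ)} (y : ModelSpace T)
    (ha : dualCone a.1.1 ≤ T) (hb : dualCone b.1.1 ≤ T)
    (hya : ∀ r : dualCone a.1.1, y ⟨r, ha r.2⟩ = a.2 r)
    (hyb : ∀ r : dualCone b.1.1, y ⟨r, hb r.2⟩ = b.2 r) : 𝓡.Compat a b := fun r r' s s' h => by
  rw [← hya, ← hya, ← hyb, ← hyb, ← y.map_add', ← y.map_add']
  exact congrArg y (Subtype.ext h)

variable (𝓡) in
/-- For two maximal monoids `R₁`, `R₂` there is `w ∈ R₁^∨ ∩ (-R₂^∨)` such that the localizations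
of `R₁^∨` and of `R₂^∨` are obtained by inverting `w`. -/
theorem exists_transition (hQ : AddMonoid.FG Q) (R₁ R₂ : 𝓡.MaxCone) :
    ∃ w : Dual Q →+ ℤ, w ∈ dualCone R₁.1 ∧ -w ∈ dualCone R₂.1 ∧
      (∀ t ∈ dualCone (R₁.1 ⊓ R₂.1), ∃ k : ℕ, t + k • w ∈ dualCone R₁.1) ∧
      (∀ t ∈ dualCone (R₁.1 ⊓ R₂.1), ∃ k : ℕ, t + k • (-w) ∈ dualCone R₂.1) := by
  obtain ⟨w, h1, h2, h3, h4⟩ := 𝓡.exists_separating hQ R₁.2.1 R₂.2.1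
  have h2' : -w ∈ dualCone R₂.1 := fun m hm => neg_nonneg.2 (h2 m hm)
  refine ⟨w, h1, h2', fun t ht => ?_, fun t ht => ?_⟩
  · exact exists_add_nsmul_mem_dualCone
      ((AddMonoid.fg_iff_addSubmonoid_fg _).1 (𝓡.toric _ R₁.2.1).fg)
      (R₁.1 ⊓ R₂.1) h1 (fun m hm hm' => h3 m hm fun h => hm' ⟨hm, h⟩) ht
  · exact exists_add_nsmul_mem_dualCone
      ((AddMonoid.fg_iff_addSubmonoid_fg _).1 (𝓡.toric _ R₂.2.1).fg)
      (R₁.1 ⊓ R₂.1) h2' (fun m hm hm' => neg_pos.2 (h4 m hm fun h => hm' ⟨h, hm⟩)) ht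

/-- For the separating `w`, this is how compatibility forces the points into the open overlap where
`x_w`, respectively `x_{-w}`, does not vanish. -/
theorem Compat.mul_eq_one (h : 𝓡.Compat a b) {w : Dual Q →+ ℤ} (hw : w ∈ dualCone a.1.1)
    (hw' : -w ∈ dualCone b.1.1) : a.2 ⟨w, hw⟩ * b.2 ⟨-w, hw'⟩ = 1 := by
  have := h ⟨w, hw⟩ 0 0 ⟨-w, hw'⟩ (by simp)
  rwa [a.2.map_zero', b.2.map_zero', mul_one] at this

/-- This is the transition formula: where `x_w ≠ 0`, coordinates of one chart are quotients of
coordinates of the other. -/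
theorem Compat.mul_pow_eq (h : 𝓡.Compat a b) {w : Dual Q →+ ℤ} (hw : w ∈ dualCone b.1.1)
    (r : dualCone a.1.1) {k : ℕ} (hr : (r : Dual Q →+ ℤ) + k • w ∈ dualCone b.1.1) :
    a.2 r * b.2 ⟨w, hw⟩ ^ k = b.2 ⟨_, hr⟩ := by
  have := h r 0 ⟨_, hr⟩ (k • ⟨w, hw⟩) (by simp)
  rwa [a.2.map_zero', one_mul, b.2.map_nsmul] at this

/-- Move the relation into the middle chart by multiplying with powers of two of its coordinates,
one for each overlap. They are nonzero at `b`, and the shifted relation is an identity inside one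
monoid. -/
theorem Compat.trans (hQ : AddMonoid.FG Q) (h : 𝓡.Compat a b) (h' : 𝓡.Compat b c) :
    𝓡.Compat a c := by
  intro r r' s s' hr
  obtain ⟨w, hw, hw', -, hwk⟩ := 𝓡.exists_transition hQ a.1 b.1
  obtain ⟨u, hu, hu', -, huk⟩ := 𝓡.exists_transition hQ c.1 b.1
  have key : ∀ {e : Σ R : 𝓡.MaxCone, ModelSpace (dualCone R.1)} {w : Dual Q →+ ℤ}
      (hw' : w ∈ dualCone b.1.1), 𝓡.Compat e b →
      (∀ t ∈ dualCone (e.1.1 ⊓ b.1.1), ∃ k : ℕ, t + k • w ∈ dualCone b.1.1) →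
      ∀ r r' : dualCone e.1.1, ∃ (k : ℕ) (t t' : dualCone b.1.1),
        (t : Dual Q →+ ℤ) = r + k • w ∧ (t' : Dual Q →+ ℤ) = r' + k • w ∧
        e.2 r * b.2 ⟨w, hw'⟩ ^ k = b.2 t ∧ e.2 r' * b.2 ⟨w, hw'⟩ ^ k = b.2 t' := by
    intro e w hw' he hk r r'
    obtain ⟨k, hk1⟩ := hk r (dualCone_anti inf_le_left r.2)
    obtain ⟨l, hk2⟩ := hk r' (dualCone_anti inf_le_left r'.2)
    have h1 := mem_dualCone_add_nsmul hw' hk1 l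
    have h2 := mem_dualCone_add_nsmul hw' hk2 k
    rw [add_comm l k] at h2
    exact ⟨k + l, ⟨_, h1⟩, ⟨_, h2⟩, rfl, rfl, he.mul_pow_eq hw' r h1, he.mul_pow_eq hw' r' h2⟩
  obtain ⟨k, t, t', ht, ht', e1, e2⟩ := key hw' h hwk r r'
  obtain ⟨l, v, v', hv, hv', e3, e4⟩ := key hu' h'.symm huk s s'
  have hb : b.2 t * b.2 v' = b.2 t' * b.2 v := by
    rw [← b.2.map_add', ← b.2.map_add']
    refine congrArg b.2 (Subtype.ext ?_)
    rw [AddSubmonoid.coe_add, AddSubmonoid.coe_add, ht, ht', hv, hv', add_add_add_comm, hr,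
      add_add_add_comm]
  have n1 := pow_ne_zero k (right_ne_zero_of_mul_eq_one (h.mul_eq_one hw hw'))
  have n2 := pow_ne_zero l (right_ne_zero_of_mul_eq_one (h'.symm.mul_eq_one hu hu'))
  refine mul_right_cancel₀ (mul_ne_zero n1 n2) ?_
  rw [mul_mul_mul_comm, e1, e4, mul_mul_mul_comm, e2, e3, hb]

/-- The localizations consist of functionals nonnegative on `R₁ ∩ R₂`, which are reached by
inverting `w` or `-w`. A common extension implies all relations. Conversely, compatibility makes
`x_w` and `x_{-w}` nonzero, so both points extend, and one more relation shows that the extensions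
agree. -/
theorem glue_iff_compat (hQ : AddMonoid.FG Q) : 𝓡.Glue a b ↔ 𝓡.Compat a b := by
  obtain ⟨w, hw, hw', hk, hk'⟩ := 𝓡.exists_transition hQ a.1 b.1
  have hwS : w ∈ annihilator (a.1.1 ⊓ b.1.1) := fun m hm =>
    le_antisymm (neg_nonneg.1 (hw' m hm.2)) (hw m hm.1)
  have hwS' : -w ∈ annihilator (a.1.1 ⊓ b.1.1) := fun m hm => by
    rw [AddMonoidHom.neg_apply, hwS m hm, neg_zero]
  have hann : annihilator (a.1.1 ⊓ b.1.1) ≤ dualCone (a.1.1 ⊓ b.1.1) := fun t ht m hm =>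
    (ht m hm).ge
  have hl : localization a.1.1 (a.1.1 ⊓ b.1.1) ≤ dualCone (a.1.1 ⊓ b.1.1) :=
    sup_le (dualCone_anti inf_le_left) hann
  have hl' : localization b.1.1 (a.1.1 ⊓ b.1.1) ≤ dualCone (a.1.1 ⊓ b.1.1) :=
    sup_le (dualCone_anti inf_le_right) hann
  have hm : dualCone (a.1.1 ⊓ b.1.1) ≤ localization a.1.1 (a.1.1 ⊓ b.1.1) := fun t ht => by
    obtain ⟨k, h⟩ := hk t ht
    have : t = (t + k • w) + k • (-w) := by simp
    rw [this]
    exact add_mem (AddSubmonoid.mem_sup_left h) (AddSubmonoid.mem_sup_right (nsmul_mem hwS' k))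
  constructor
  · rintro ⟨y₁, y₂, h₁, h₂, h⟩
    refine compat_of_extension y₁ (dualCone_le_localization _ _)
      ((dualCone_anti inf_le_right).trans hm) (fun r => ?_) (fun r => ?_)
    · rw [← h₁]; rfl
    · rw [← h₂]
      exact h _ _ (dualCone_le_localization _ _ r.2)
  · intro h
    have h1 := h.mul_eq_one hw hw'
    obtain ⟨y₁, hy₁⟩ := a.2.exists_extension_of_ne_zero ⟨w, hw⟩ (left_ne_zero_of_mul_eq_one h1)
      (localization a.1.1 (a.1.1 ⊓ b.1.1)) fun t ht => hk t (hl ht)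
    obtain ⟨y₂, hy₂⟩ := b.2.exists_extension_of_ne_zero ⟨-w, hw'⟩ (right_ne_zero_of_mul_eq_one h1)
      (localization b.1.1 (a.1.1 ⊓ b.1.1)) fun t ht => hk' t (hl' ht)
    refine ⟨y₁, y₂, ?_, ?_, fun t ht ht' => ?_⟩
    · ext r : 2
      change y₁ ⟨r, dualCone_le_localization _ _ r.2⟩ = _
      have := hy₁ ⟨r, dualCone_le_localization _ _ r.2⟩ 0 (by simp)
      simpa using this
    · ext r : 2
      change y₂ ⟨r, dualCone_le_localization _ _ r.2⟩ = _
      have := hy₂ ⟨r, dualCone_le_localization _ _ r.2⟩ 0 (by simp)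
      simpa using this
    · obtain ⟨k, hkt⟩ := hk t (hl ht)
      obtain ⟨l, hlt⟩ := hk' t (hl ht)
      have e1 := hy₁ ⟨t, ht⟩ k hkt
      have e2 := hy₂ ⟨t, ht'⟩ l hlt
      have e3 := h ⟨_, hkt⟩ (k • ⟨w, hw⟩) ⟨_, hlt⟩ (l • ⟨-w, hw'⟩) (by simp; abel)
      rw [a.2.map_nsmul, b.2.map_nsmul, ← e1, ← e2] at e3
      have n1 := pow_ne_zero k (left_ne_zero_of_mul_eq_one h1)
      have n2 := pow_ne_zero l (right_ne_zero_of_mul_eq_one h1)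
      refine mul_right_cancel₀ (mul_ne_zero n1 n2) ?_
      linear_combination e3

/-- Gluing is already an equivalence relation, so no chains of identifications have to be
considered. -/
theorem glued_mk_eq_iff (hQ : AddMonoid.FG Q) :
    (Quot.mk 𝓡.Glue a : 𝓡.Glued) = Quot.mk 𝓡.Glue b ↔ 𝓡.Compat a b := by
  have : Equivalence 𝓡.Glue :=
    ⟨fun _ => (glue_iff_compat hQ).2 .refl,
      fun h => (glue_iff_compat hQ).2 ((glue_iff_compat hQ).1 h).symm,
      fun h h' => (glue_iff_compat hQ).2
        (((glue_iff_compat hQ).1 h).trans hQ ((glue_iff_compat hQ).1 h'))⟩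
  rw [← glue_iff_compat hQ]
  exact Quot.eq.trans this.eqvGen_iff

theorem continuous_chart (R : 𝓡.MaxCone) : Continuous (𝓡.chart R) :=
  continuous_quot_mk.comp continuous_sigmaMk

theorem chart_injective (hQ : AddMonoid.FG Q) (R : 𝓡.MaxCone) :
    Function.Injective (𝓡.chart R) := fun _ _ h => ((glued_mk_eq_iff hQ).1 h).eq

/-- The transition maps between charts. -/
theorem exists_compat_of_ne_zero {R₁ R₂ : 𝓡.MaxCone} {w : Dual Q →+ ℤ} (hw : w ∈ dualCone R₂.1)
    (hk : ∀ t ∈ dualCone (R₁.1 ⊓ R₂.1), ∃ k : ℕ, t + k • w ∈ dualCone R₂.1)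
    (x : ModelSpace (dualCone R₂.1)) (hx : x ⟨w, hw⟩ ≠ 0) :
    ∃ z : ModelSpace (dualCone R₁.1), 𝓡.Compat ⟨R₁, z⟩ ⟨R₂, x⟩ := by
  obtain ⟨y, hy⟩ := x.exists_extension_of_ne_zero ⟨w, hw⟩ hx _ hk
  refine ⟨y.comap (AddSubmonoid.inclusion (dualCone_anti inf_le_left)),
    compat_of_extension y (dualCone_anti inf_le_left) (dualCone_anti inf_le_right)
      (fun r => rfl) fun r => ?_⟩
  have := hy ⟨r, dualCone_anti inf_le_right r.2⟩ 0 (by simp)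
  simpa using this

/-- In another chart, the image of `U` becomes the part of the open set `x_{-w} ≠ 0` that the
continuous transition map `ψ` sends into `U`. -/
theorem isOpenMap_chart (hQ : AddMonoid.FG Q) (R : 𝓡.MaxCone) : IsOpenMap (𝓡.chart R) := by
  intro U hU
  refine isQuotientMap_quot_mk.isOpen_preimage.1 (isOpen_sigma_iff.2 fun R₂ => ?_)
  obtain ⟨w, hw, hw', -, hk⟩ := 𝓡.exists_transition hQ R R₂
  let N : Set (ModelSpace (dualCone R₂.1)) := {x | x ⟨-w, hw'⟩ ≠ 0}
  have hN : IsOpen N := isOpen_compl_singleton.preimage (ModelSpace.continuous_eval _)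
  have hex : ∀ x ∈ N, ∃ z : ModelSpace (dualCone R.1), 𝓡.Compat ⟨R, z⟩ ⟨R₂, x⟩ := fun x hx =>
    exists_compat_of_ne_zero hw' hk x hx
  choose! ψ hψ using hex
  have hc : ContinuousOn ψ N := ModelSpace.continuousOn_iff.2 fun r => by
    obtain ⟨k, hr⟩ := hk r (dualCone_anti inf_le_left r.2)
    have h1 : ContinuousOn (fun x : ModelSpace (dualCone R₂.1) => x ⟨_, hr⟩ / x ⟨-w, hw'⟩ ^ k) N :=
      (ModelSpace.continuous_eval _).continuousOn.div
        ((ModelSpace.continuous_eval _).pow k).continuousOn fun x hx => pow_ne_zero k hx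
    refine h1.congr fun x hx => ?_
    rw [eq_div_iff (pow_ne_zero k hx)]
    exact (hψ x hx).mul_pow_eq hw' r hr
  convert hc.isOpen_inter_preimage hN hU using 1
  ext x
  constructor
  · rintro ⟨z, hz, hzx⟩
    have h1 : 𝓡.Compat ⟨R, z⟩ ⟨R₂, x⟩ := (glued_mk_eq_iff hQ).1 hzx
    have hxN : x ∈ N := right_ne_zero_of_mul_eq_one (h1.mul_eq_one hw hw')
    refine ⟨hxN, ?_⟩
    rwa [mem_preimage, ← (h1.trans hQ (hψ x hxN).symm).eq]
  · rintro ⟨hxN, hxU⟩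
    exact ⟨ψ x, hxU, (glued_mk_eq_iff hQ).2 (hψ x hxN)⟩

theorem isOpenEmbedding_chart (hQ : AddMonoid.FG Q) (R : 𝓡.MaxCone) :
    IsOpenEmbedding (𝓡.chart R) :=
  .of_continuous_injective_isOpenMap (continuous_chart R) (chart_injective hQ R)
    (isOpenMap_chart hQ R)

end Refinement

/-! ### Uniqueness of lifts. -/

section Uniqueness

variable {P Q : Type*} [AddCommMonoid P] [AddCommMonoid Q] {𝓡 : Refinement (Dual Q)}

theorem mul_eval_eq {R : AddSubmonoid (Dual Q)} (x : ModelSpace (dualCone R)) {r : dualCone R}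
    {a b : Q} (h : ∀ m : Dual Q, (r : Dual Q →+ ℤ) m = (m a : ℤ) - m b) :
    x r * x (evalHom R b) = x (evalHom R a) := by
  rw [← x.map_add']
  refine congrArg x (Subtype.ext (AddMonoidHom.ext fun m => ?_))
  change (r : Dual Q →+ ℤ) m + (m b : ℤ) = m a
  rw [h m]; ring

/-- The blow-down map is injective over points with nonzero coordinates. -/
theorem compat_of_sharpBlowDown_eq (hQ : IsToric Q)
    {a b : Σ R : 𝓡.MaxCone, ModelSpace (dualCone R.1)}
    (h : ∀ q, a.2 (evalHom a.1.1 q) = b.2 (evalHom b.1.1 q))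
    (h0 : ∀ q, a.2 (evalHom a.1.1 q) ≠ 0) : 𝓡.Compat a b := by
  intro r r' s s' hr
  obtain ⟨a₁, a₂, ha⟩ := hQ.exists_eq_eval_sub_eval r
  obtain ⟨c₁, c₂, hc⟩ := hQ.exists_eq_eval_sub_eval r'
  obtain ⟨d₁, d₂, hd⟩ := hQ.exists_eq_eval_sub_eval s
  obtain ⟨e₁, e₂, he⟩ := hQ.exists_eq_eval_sub_eval s'
  have ea := mul_eval_eq a.2 ha
  have ec := mul_eval_eq a.2 hc
  have ed := mul_eval_eq b.2 hd
  have ee := mul_eval_eq b.2 he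
  rw [← h, ← h] at ed ee
  -- The relation with denominators cleared: both sides define the same evaluation on `Q^∨`.
  have hev : a.2 (evalHom a.1.1 (a₁ + e₁ + c₂ + d₂)) = a.2 (evalHom a.1.1 (c₁ + d₁ + a₂ + e₂)) := by
    refine congrArg a.2 (Subtype.ext (AddMonoidHom.ext fun m => ?_))
    change ((m (a₁ + e₁ + c₂ + d₂) : ℕ) : ℤ) = (m (c₁ + d₁ + a₂ + e₂) : ℕ)
    have h1 := DFunLike.congr_fun hr m
    rw [AddMonoidHom.add_apply, AddMonoidHom.add_apply, ha, hc, hd, he] at h1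
    simp only [map_add]
    push_cast
    linarith
  simp only [map_add, a.2.map_add'] at hev
  have n := mul_ne_zero (mul_ne_zero (h0 a₂) (h0 e₂)) (mul_ne_zero (h0 c₂) (h0 d₂))
  refine mul_right_cancel₀ n ?_
  calc _ = (a.2 r * a.2 (evalHom a.1.1 a₂)) * (b.2 s' * a.2 (evalHom a.1.1 e₂)) *
        a.2 (evalHom a.1.1 c₂) * a.2 (evalHom a.1.1 d₂) := by ring
    _ = (a.2 r' * a.2 (evalHom a.1.1 c₂)) * (b.2 s * a.2 (evalHom a.1.1 d₂)) *
        a.2 (evalHom a.1.1 a₂) * a.2 (evalHom a.1.1 e₂) := by rw [ea, ec, ed, ee, hev]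
    _ = _ := by ring

theorem evalHom_eq_zero_of_isAddUnit (R : AddSubmonoid (Dual Q)) {q : Q} (hq : IsAddUnit q) :
    evalHom R q = 0 :=
  Subtype.ext (AddMonoidHom.ext fun m => by
    change (m q : ℤ) = 0
    rw [dual_eq_zero_of_isAddUnit m hq, Nat.cast_zero])

theorem blowDown_mk_apply (σ : Splitting Q) (a : Σ R : 𝓡.MaxCone, ModelSpace (dualCone R.1))
    (u : ModelSpace (AddUnits Q)) (q : Q) :
    blowDown 𝓡 σ (Quot.mk _ a, u) q = a.2 (evalHom a.1.1 q) * u (σ.retract q) := rfl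

/-- Units of `Q` evaluate to zero on `Q^∨`, so the sharp factor contributes `1`. Thus `β` determines
the second factor of the blow-up. -/
theorem blowDown_unit (σ : Splitting Q) (z : BlowUp 𝓡) (u : AddUnits Q) :
    blowDown 𝓡 σ z u = z.2 u := by
  obtain ⟨⟨a⟩, v⟩ := z
  change blowDown 𝓡 σ (Quot.mk _ a, v) u = v u
  rw [blowDown_mk_apply, evalHom_eq_zero_of_isAddUnit _ u.isAddUnit, a.2.map_zero', one_mul,
    σ.retract_coe]

theorem sharpBlowDown_eq_div (σ : Splitting Q) (z : BlowUp 𝓡) (q : Q) :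
    sharpBlowDown 𝓡 z.1 q = blowDown 𝓡 σ z q / blowDown 𝓡 σ z (σ.retract q : Q) := by
  rw [blowDown_unit, eq_div_iff (z.2.ne_zero_of_isAddUnit (AddGroup.isAddUnit _))]
  rfl

/-- Continuous maps to the blow-up are determined by their composition with the blow-down map, if
this composition maps points with nonzero coordinates to such points. -/
theorem eqOn_of_blowDown_eqOn (hP : IsToric P) (hQ : IsToric Q) (σ : Splitting Q)
    {O : Set (ModelSpace P)} (hO : IsOpen O) {F F' : ModelSpace P → BlowUp 𝓡}
    (hF : ContinuousOn F O) (hF' : ContinuousOn F' O)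
    (h : EqOn (blowDown 𝓡 σ ∘ F) (blowDown 𝓡 σ ∘ F') O)
    (h0 : ∀ y ∈ O, (∀ p, y p ≠ 0) → ∀ q, blowDown 𝓡 σ (F y) q ≠ 0) : EqOn F F' O := by
  intro y hy
  have hy' : blowDown 𝓡 σ (F y) = blowDown 𝓡 σ (F' y) := h hy
  refine Prod.ext ?_ (ModelSpace.ext (funext fun u => ?_))
  swap
  · rw [← blowDown_unit σ, hy', blowDown_unit]
  -- Charts are open embeddings, so near `y` a continuous map has continuous coordinates in a single
  -- chart.
  have key : ∀ G : ModelSpace P → BlowUp 𝓡, ContinuousOn G O →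
      ∃ (R : 𝓡.MaxCone) (X : ModelSpace P → ModelSpace (dualCone R.1)),
        Tendsto X (𝓝[O] y) (𝓝 (X y)) ∧ (G y).1 = 𝓡.chart R (X y) ∧
        ∀ᶠ y' in 𝓝[O] y, (G y').1 = 𝓡.chart R (X y') := by
    intro G hG
    obtain ⟨⟨R, x⟩, hRx⟩ := Quot.exists_rep (G y).1
    have hopen := Refinement.isOpenEmbedding_chart hQ.fg R
    have hG1 : Tendsto (fun y' => (G y').1) (𝓝[O] y) (𝓝 (G y).1) :=
      continuous_fst.continuousAt.tendsto.comp (hG y hy)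
    have hmem : (G y).1 ∈ range (𝓡.chart R) := ⟨x, hRx⟩
    have hev : ∀ᶠ y' in 𝓝[O] y, (G y').1 ∈ range (𝓡.chart R) :=
      hG1.eventually (hopen.isOpen_range.mem_nhds hmem)
    let X := fun y' => Function.invFun (𝓡.chart R) (G y').1
    have hX : ∀ y', (G y').1 ∈ range (𝓡.chart R) → 𝓡.chart R (X y') = (G y').1 := fun y' hy' =>
      Function.invFun_eq hy'
    refine ⟨R, X, ?_, (hX y hmem).symm, hev.mono fun y' h => (hX y' h).symm⟩
    rw [hopen.isInducing.tendsto_nhds_iff, hX y hmem]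
    exact hG1.congr' (hev.mono fun y' h => (hX y' h).symm)
  obtain ⟨R, X, hX, hXy, hXe⟩ := key F hF
  obtain ⟨R', X', hX', hXy', hXe'⟩ := key F' hF'
  rw [hXy, hXy']
  refine (Refinement.glued_mk_eq_iff hQ.fg).2 fun r r' s s' hr => ?_
  have hne : (𝓝[O ∩ {y | ∀ p, y p ≠ 0}] y).NeBot :=
    mem_closure_iff_nhdsWithin_neBot.1 (hP.dense_interior.open_subset_closure_inter hO hy)
  have hle : 𝓝[O ∩ {y | ∀ p, y p ≠ 0}] y ≤ 𝓝[O] y := nhdsWithin_mono y inter_subset_left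
  have lim : ∀ {R : 𝓡.MaxCone} {X : ModelSpace P → ModelSpace (dualCone R.1)},
      Tendsto X (𝓝[O] y) (𝓝 (X y)) → ∀ r, Tendsto (fun y' => X y' r)
        (𝓝[O ∩ {y | ∀ p, y p ≠ 0}] y) (𝓝 (X y r)) := fun hX r =>
    ((ModelSpace.continuous_eval r).tendsto _).comp (hX.mono_left hle)
  -- Each compatibility equation is closed: it holds at nearby points with nonzero coordinates and
  -- survives the limit at `y`, even if `F` and `F'` use different charts.
  refine tendsto_nhds_unique_of_eventuallyEq ((lim hX r).mul (lim hX' s'))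
    ((lim hX r').mul (lim hX' s)) ?_
  filter_upwards [hle hXe, hle hXe', self_mem_nhdsWithin] with y' h1 h2 h3
  have e1 : ∀ q, sharpBlowDown 𝓡 (F y').1 q = X y' (evalHom R.1 q) := fun q => by rw [h1]; rfl
  have e2 : ∀ q, sharpBlowDown 𝓡 (F' y').1 q = X' y' (evalHom R'.1 q) := fun q => by rw [h2]; rfl
  have h3' : blowDown 𝓡 σ (F y') = blowDown 𝓡 σ (F' y') := h h3.1
  refine compat_of_sharpBlowDown_eq hQ (a := ⟨R, X y'⟩) (b := ⟨R', X' y'⟩) (fun q => ?_)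
    (fun q => ?_) r r' s s' hr
  · rw [← e1, ← e2, sharpBlowDown_eq_div σ, sharpBlowDown_eq_div σ, h3']
  · rw [← e1, sharpBlowDown_eq_div σ]
    exact div_ne_zero (h0 y' h3.1 h3.2 q) (h0 y' h3.1 h3.2 _)

end Uniqueness

/-! ### Construction of the lift. -/

section Existence

variable {P Q : Type*} [AddCommMonoid P] [AddCommMonoid Q]

/-- The component in the sharp part of an element of a split monoid. -/
def Splitting.sharpPart (σ : Splitting Q) (q : Q) : Q := q + ((-σ.retract q : AddUnits Q) : Q)

theorem Splitting.retract_sharpPart (σ : Splitting Q) (q : Q) :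
    σ.retract (σ.sharpPart q) = 0 := by
  rw [sharpPart, map_add, σ.retract_coe, add_neg_cancel]

theorem Splitting.eval_sharpPart (σ : Splitting Q) (q : Q) (m : Dual Q) :
    m (σ.sharpPart q) = m q := by
  rw [sharpPart, map_add, dual_eq_zero_of_isAddUnit m (AddUnits.isAddUnit _), add_zero]

/-- If `f_♮` maps to `R`, then each element of `R^∨` pulls back to a b-function under `f`. -/
theorem exists_pullback_dualCone (hP : IsToric P) (hQ : IsToric Q) (σ : Splitting Q)
    {O : Set (ModelSpace P)} (hO : IsOpen O) {f : ModelSpace P → ModelSpace Q}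
    (hf : IsInteriorBMapOn O f) {x : ModelSpace P} (hx : x ∈ O) (hxmin : x ∈ ModelSpace.minFace P)
    {R : AddSubmonoid (Dual Q)} (hR : ∀ v, natural hO hf hx v ∈ R) (s : dualCone R) :
    ∃ (a b : Q) (p : P) (h : ModelSpace P → ℝ≥0), IsSmoothPosOn O h ∧
      (∀ m : Dual Q, (s : Dual Q →+ ℤ) m = (m a : ℤ) - m b) ∧ σ.retract a = 0 ∧
      σ.retract b = 0 ∧ ∀ y ∈ O, f y a = h y * y p * f y b := by
  obtain ⟨a, b, hab⟩ := hQ.exists_eq_eval_sub_eval s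
  -- Removing unit parts keeps the values on `Q^∨` and makes later identities in `Q` checkable on
  -- `Q^∨` alone.
  obtain ⟨p₁, h₁, hh₁, hf₁⟩ := hf (σ.sharpPart a)
  obtain ⟨p₂, h₂, hh₂, hf₂⟩ := hf (σ.sharpPart b)
  -- Realize `w` by a normal vector `v`. Then `s(f_♮ v) = w(p₁) - w(p₂)`, which is nonnegative
  -- because `f_♮ v ∈ R`.
  obtain ⟨d, rfl⟩ := hP.exists_eq_add (a := p₁) (b := p₂) fun w => by
    obtain ⟨v, hv⟩ := hP.exists_normal hxmin w
    have h1 : natural hO hf hx v (σ.sharpPart a) = w p₁ := hv _ _ O p₁ h₁ hO hx hh₁ hf₁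
    have h2 : natural hO hf hx v (σ.sharpPart b) = w p₂ := hv _ _ O p₂ h₂ hO hx hh₂ hf₂
    have h3 := s.2 _ (hR v)
    rw [hab, ← σ.eval_sharpPart a, ← σ.eval_sharpPart b, h1, h2] at h3
    omega
  refine ⟨σ.sharpPart a, σ.sharpPart b, d, fun y => h₁ y * (h₂ y)⁻¹, hh₁.mul hh₂.inv,
    fun m => ?_, σ.retract_sharpPart a, σ.retract_sharpPart b, fun y hy => ?_⟩
  · rw [hab, σ.eval_sharpPart, σ.eval_sharpPart]
  · have := (hh₂.2 y hy).ne'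
    rw [hf₁ y hy, hf₂ y hy, y.map_add']
    field_simp

/-- The lift of `f` to the chart `X_{R^∨}`. -/
theorem exists_lift_chart (hP : IsToric P) (hQ : IsToric Q) (σ : Splitting Q)
    {O : Set (ModelSpace P)} (hO : IsOpen O) {f : ModelSpace P → ModelSpace Q}
    (hf : IsInteriorBMapOn O f) {x : ModelSpace P} (hx : x ∈ O) (hxmin : x ∈ ModelSpace.minFace P)
    {R : AddSubmonoid (Dual Q)} (hR : ∀ v, natural hO hf hx v ∈ R) :
    ∃ φ : ModelSpace P → ModelSpace (dualCone R), IsInteriorBMapOn O φ ∧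
      ∀ y ∈ O, ∀ q : Q, φ y (evalHom R q) * f y (σ.retract q : Q) = f y q := by
  classical
  choose a b p h hh hab ha hb hfab using
    exists_pullback_dualCone hP hQ σ hO hf hx hxmin hR
  have hc : ∀ s, ContinuousOn (fun y => h s y * y (p s)) O := fun s =>
    (hh s).continuousOn.mul (ModelSpace.continuous_eval _).continuousOn
  have hcf : ∀ q, ContinuousOn (fun y => f y q) O :=
    ModelSpace.continuousOn_iff.1 hf.continuousOn
  have key : ∀ y ∈ O, ∀ s t : dualCone R,
      h (s + t) y * y (p (s + t)) = h s y * y (p s) * (h t y * y (p t)) := fun y hy s t => by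
    refine hP.eqOn_of_interior hO (hc (s + t)) ((hc s).mul (hc t)) (fun y hy hy0 => ?_) hy
    have n := hf.ne_zero hy hy0
    have he : a (s + t) + b s + b t = b (s + t) + a s + a t := by
      refine σ.eq_of_eval_eq hQ (fun m => ?_) (by simp only [map_add, ha, hb])
      have h1 := hab (s + t) m
      rw [AddSubmonoid.coe_add, AddMonoidHom.add_apply, hab, hab] at h1
      simp only [map_add]
      omega
    have h2 := congrArg (f y) he
    simp only [(f y).map_add', hfab _ y hy] at h2
    refine mul_right_cancel₀ (mul_ne_zero (mul_ne_zero (n (b (s + t))) (n (b s))) (n (b t))) ?_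
    rw [Pi.mul_apply]
    linear_combination h2
  -- At points with nonzero coordinates this value is a nonzero idempotent, hence `1`.
  have key0 : ∀ y ∈ O, h 0 y * y (p 0) = 1 := fun y hy => by
    refine hP.eqOn_of_interior hO (hc 0) continuousOn_const (fun y hy hy0 => ?_) hy
    have n : h 0 y * y (p 0) ≠ 0 := mul_ne_zero ((hh 0).2 y hy).ne' (hy0 _)
    have h1 := key y hy 0 0
    rw [add_zero] at h1
    exact (mul_eq_left₀ n).1 h1.symm
  refine ⟨fun y => if hy : y ∈ O then ⟨fun s => h s y * y (p s), key0 y hy, key y hy⟩ else default,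
    fun s => ⟨p s, h s, hh s, fun y hy => by dsimp only; rw [dif_pos hy]⟩, fun y hy q => ?_⟩
  beta_reduce
  rw [dif_pos hy]
  change h (evalHom R q) y * y (p (evalHom R q)) * f y (σ.retract q : Q) = f y q
  set s := evalHom R q with hs
  refine hP.eqOn_of_interior hO ((hc s).mul (hcf _)) (hcf q) (fun y hy hy0 => ?_) hy
  have he : q + b s = a s + (σ.retract q : Q) := by
    refine σ.eq_of_eval_eq hQ (fun m => ?_) (by
      rw [map_add, map_add, ha, hb, σ.retract_coe, add_zero, zero_add])
    have h1 := hab s m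
    have h2 : (s : Dual Q →+ ℤ) m = m q := rfl
    rw [map_add, map_add, dual_eq_zero_of_isAddUnit m (AddUnits.isAddUnit _)]
    omega
  have h2 := congrArg (f y) he
  rw [(f y).map_add', (f y).map_add', hfab s y hy] at h2
  refine mul_right_cancel₀ (hf.ne_zero hy hy0 (b s)) ?_
  rw [Pi.mul_apply]
  linear_combination h2.symm

/-- A map to a chart of the blow-up that is an interior b-map is an interior b-map in the other
charts. -/
theorem isInteriorBMapToBlowUpOn_chart (hQ : AddMonoid.FG Q) (𝓡 : Refinement (Dual Q))
    (R : 𝓡.MaxCone) {O : Set (ModelSpace P)} {φ : ModelSpace P → ModelSpace (dualCone R.1)}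
    (hφ : IsInteriorBMapOn O φ) {u : ModelSpace P → ModelSpace (AddUnits Q)}
    (hu : IsInteriorBMapOn O u) :
    IsInteriorBMapToBlowUpOn 𝓡 O fun y => (𝓡.chart R (φ y), u y) := by
  refine ⟨(((Refinement.continuous_chart R).comp_continuousOn hφ.continuousOn).prodMk
    hu.continuousOn), fun R' => ?_⟩
  let X := fun y => Function.invFun (𝓡.chart R') (𝓡.chart R (φ y))
  have hX : ∀ y, 𝓡.chart R (φ y) ∈ range (𝓡.chart R') → 𝓡.chart R' (X y) = 𝓡.chart R (φ y) :=
    fun y hy => Function.invFun_eq hy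
  refine ⟨X, fun y _ hy => hX y hy, ?_⟩
  rintro ⟨s, e⟩
  obtain ⟨w, hw, hw', hk, -⟩ := 𝓡.exists_transition hQ R R'
  obtain ⟨k, hs⟩ := hk s (dualCone_anti inf_le_right s.2)
  obtain ⟨p, h, hh, hφs⟩ := hφ ⟨_, hs⟩
  obtain ⟨p', h', hh', hφw⟩ := hφ ⟨w, hw⟩
  obtain ⟨p'', h'', hh'', hue⟩ := hu e
  set O' := {y | y ∈ O ∧ ((fun y => (𝓡.chart R (φ y), u y)) y).1 ∈ range (𝓡.chart R')}
  have hO' : O' ⊆ O := fun y hy => hy.1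
  have hcompat : ∀ y ∈ O', 𝓡.Compat ⟨R', X y⟩ ⟨R, φ y⟩ := fun y hy =>
    (Refinement.glued_mk_eq_iff hQ).1 (hX y hy.2)
  have hw0 : ∀ y ∈ O', φ y ⟨w, hw⟩ ≠ 0 := fun y hy =>
    left_ne_zero_of_mul_eq_one ((hcompat y hy).symm.mul_eq_one hw hw')
  have hp' : ∀ y ∈ O', 0 < y p' := fun y hy => by
    have := hw0 y hy
    rw [hφw y hy.1] at this
    exact pos_iff_ne_zero.2 (right_ne_zero_of_mul this)
  -- On the overlap `x_w = h' x_{p'}` is nonzero, so `x_{p'}` is a positive smooth function there.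
  -- The denominator of the transition formula is thus absorbed into the smooth factor.
  refine ⟨p + p'', fun y => h y * ((h' y * y p') ^ k)⁻¹ * h'' y,
    ((hh.mono hO').mul (((hh'.mono hO').mul (.coord hp')).pow k).inv).mul (hh''.mono hO'),
    fun y hy => ?_⟩
  change X y s * u y e = _
  have h1 := (hcompat y hy).mul_pow_eq hw s hs
  have h2 := pow_ne_zero k (hw0 y hy)
  rw [← eq_div_iff h2] at h1
  dsimp only at h1
  rw [h1, hue y hy.1, hφs y hy.1, hφw y hy.1, y.map_add']
  ring

/-- The composition of an interior b-map with the map induced by a homomorphism. -/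
theorem IsInteriorBMapOn.comap {N : Type*} [AddCommMonoid N] {O : Set (ModelSpace P)}
    {f : ModelSpace P → ModelSpace Q} (hf : IsInteriorBMapOn O f) (φ : N →+ Q) :
    IsInteriorBMapOn O fun y => (f y).comap φ := fun q => hf (φ q)

end Existence

end GenCorners

/-! ### The lifting theorem. -/

open GenCorners in
theorem lemma3p5 {P Q : Type*} [AddCommMonoid P] [AddCommMonoid Q]
    (hP : IsToric P) (hQ : IsToric Q) (σ : Splitting Q) (𝓡 : Refinement (Dual Q))
    (O : Set (ModelSpace P)) (hO : IsOpen O)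
    (f : ModelSpace P → ModelSpace Q) (hf : IsInteriorBMapOn O f)
    (x : ModelSpace P) (hx : x ∈ O)
    (hxmin : x ∈ ModelSpace.minFace P) (hfxmin : f x ∈ ModelSpace.minFace Q)
    (R : AddSubmonoid (Dual Q)) (hR : R ∈ 𝓡.cones)
    (hfac : ∃ g : NormalMonoid x →+ R, ∀ v, (g v : Dual Q) = natural hO hf hx v) :
    ∃ F : ModelSpace P → BlowUp 𝓡,
      IsInteriorBMapToBlowUpOn 𝓡 O F ∧ Set.EqOn (blowDown 𝓡 σ ∘ F) f O ∧
      ∀ F' : ModelSpace P → BlowUp 𝓡, ContinuousOn F' O →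
        Set.EqOn (blowDown 𝓡 σ ∘ F') f O → Set.EqOn F' F O := by
  -- Only maximal monoids have charts; factoring through `R` implies that `f_♮` lands in `R'`.
  obtain ⟨R', hR', hle, hdim⟩ := 𝓡.le_maximal R hR
  obtain ⟨g, hg⟩ := hfac
  have hnat : ∀ v, natural hO hf hx v ∈ R' := fun v => hg v ▸ hle (g v).2
  obtain ⟨φ, hφ, hφf⟩ := exists_lift_chart hP hQ σ hO hf hx hxmin hnat
  let F : ModelSpace P → BlowUp 𝓡 := fun y =>
    (𝓡.chart ⟨R', hR', hdim⟩ (φ y), (f y).comap (AddUnits.coeHom Q))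
  have hF : IsInteriorBMapToBlowUpOn 𝓡 O F :=
    isInteriorBMapToBlowUpOn_chart hQ.fg 𝓡 ⟨R', hR', hdim⟩ hφ (hf.comap (AddUnits.coeHom Q))
  have hβ : Set.EqOn (blowDown 𝓡 σ ∘ F) f O := fun y hy =>
    ModelSpace.ext (funext fun q => hφf y hy q)
  refine ⟨F, hF, hβ, fun F' hF' hβ' => ?_⟩
  refine eqOn_of_blowDown_eqOn hP hQ σ hO hF' hF.1 (hβ'.trans hβ.symm) fun y hy hy0 q => ?_
  have h1 : blowDown 𝓡 σ (F' y) = f y := hβ' hy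
  rw [h1]
  exact hf.ne_zero hy hy0 q
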